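/- Let $n\ge 0$. The $0$-Hecke algebra $H_n(0)$ is the $\mathbb C$-algebra generated by $\pi_1,\dots,\pi_{n-1}$ with relations $\pi_i^2=\pi_i$, $\pi_i\pi_{i+1}\pi_i=\pi_{i+1}\pi_i\pi_{i+1}$, and $\pi_i\pi_j=\pi_j\pi_i$ for $|i-j|\ge 2$. For a permutation $\sigma$ of $\{1,\dots,n\}$ put $\pi_\sigma=\pi_{i_1}\cdots\pi_{i_p}$ for any reduced expression $\sigma=s_{i_1}\cdots s_{i_p}$ in the transpositions $s_i=(i\ \,i{+}1)$, and put $\pi_{[a,b]}=\pi_a\pi_{a+1}\cdots\pi_b$. For a composition $\alpha=(\alpha_1,\dots,\alpha_\ell)$ of $n$ let $m_i=\alpha_1+\dots+\alpha_i$ ($m_0=0$), $\mathrm{set}(\alpha)=\{m_1,\dots,m_{\ell-1}\}$ and $\mathcal I(\alpha)=\{1\le i\le \ell-1 : \alpha_{i+1}\ne 1\}$. *The module $\mathbf P_\alpha$.* The ribbon diagram of $\alpha$ is the connected skew diagram without $2\times 2$ boxes whose $i$th column from the left has $\alpha_i$ boxes (the bottom box of column $i+1$ lies in the row of the top box of column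 $i$). A standard ribbon tableau of shape $\alpha$ is a bijective filling of it with $1,\dots,n$ whose rows increase from left to right and whose columns increase from top to bottom. $\mathbf P_\alpha$ is the $\mathbb C$-span of these tableaux, with $\pi_i\cdot T=T$ if $i$ is strictly above $i+1$ in $T$, $\pi_i\cdot T=0$ if $i$ and $i+1$ are in the same row, and $\pi_i\cdot T=s_i\cdot T$ (exchange $i$ and $i+1$) if $i$ is strictly below $i+1$. The source tableau $T_\alpha$ is filled with $1,\dots,n$ column by column from left to right, each column from top to bottom. *The module $\mathcal V_\alpha$.* The composition diagram of $\alpha$ is left-justified with $\alpha_i$ boxes in the $i$th row from the top. A standard immaculate tableau of shape $\alpha$ is a bijective filling of it with $1,\dots,n$ whose rows increase from left to right and whose first column increases from top to bottom; $\mathrm{Des}(T)$ is the set of $i\in\{1,\dots,n-1\}$ such that $i$ is strictly above $i+1$ in $T$. $\mathcal V_\alpha$ is the $\mathbb C$-span of these tableaux, with $\pi_i\cdot T=T$ if $i\notin\mathrm{Des}(T)$, $\pi_i\cdot T=0$ if $i\in\mathrm{Des}(T)$ and $i,i+1$ are both in the first column, and $\pi_i\cdot T=s_i\cdot T$ otherwise.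 Let $\alpha,\beta$ be compositions of $n$, and fix a linear extension $\preccurlyeq_L$ of the partial order on the standard immaculate tableaux of shape $\beta$ in which $\tau'\preccurlyeq\tau$ if and only if $\tau'=\pi_\gamma\cdot\tau$ for some permutation $\gamma$. For $f\in\mathrm{Hom}_{H_n(0)}(\mathbf P_\alpha,\mathcal V_\beta)$ write $f(T_\alpha)=\sum_{T}c_{f,T}\,T$, the sum over the standard immaculate tableaux $T$ of shape $\beta$, and let $\mathrm{Lead}(f)$ be the largest $T$ for $\preccurlyeq_L$ with $c_{f,T}\neq 0$ (and $\emptyset$ if $f=0$). Let $\mathfrak B$ be the set of standard immaculate tableaux $U$ of shape $\beta$ with $\mathrm{Des}(U)=\mathrm{set}(\alpha)$. **Theorem 5.6.** (a) For each $U\in\mathfrak B$ there is a unique homomorphism $f_U\in\mathrm{Hom}_{H_n(0)}(\mathbf P_\alpha,\mathcal V_\beta)$ with $\mathrm{Lead}(f_U)=U$, $c_{f_U,U}=1$, and $c_{f_U,U'}=0$ for all $U'\in\mathfrak B\setminus\{U\}$. (b) The dimension of $\mathrm{Hom}_{H_n(0)}(\mathcal V_\alpha,\mathcal V_\beta)$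 equals the dimension of $$\Bigl\{(c_U)_{U\in\mathfrak B}\in\mathbb C^{|\mathfrak B|} : \sum_{U\in\mathfrak B} c_U\,\pi_{[m_{i-1}+1,\,m_i]}\cdot f_U(T_\alpha)=0\ \text{ for all } i\in\mathcal I(\alpha)\Bigr\}.$$ -/

import Mathlib

noncomputable section

namespace ZeroHecke

/-- The letters `1, …, n` that fill a tableau with `n` boxes. -/
abbrev Entry (n : ℕ) := {k : ℕ // 1 ≤ k ∧ k ≤ n}

/-- The indices `1, …, n - 1` of the generators. -/
abbrev Gen (n : ℕ) := {k : ℕ // 1 ≤ k ∧ k + 1 ≤ n}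

/-- The letter `i`. -/
def Gen.lo {n : ℕ} (i : Gen n) : Entry n := ⟨i.1, i.2.1, by have := i.2; omega⟩

/-- The letter `i + 1`. -/
def Gen.hi {n : ℕ} (i : Gen n) : Entry n := ⟨i.1 + 1, by omega, i.2.2⟩

/-! ### The 0-Hecke algebra -/

/-- The defining relations of the 0-Hecke algebra. -/
inductive Rel (n : ℕ) : FreeAlgebra ℂ (Gen n) → FreeAlgebra ℂ (Gen n) → Prop
  | idem (i : Gen n) :
      Rel n (FreeAlgebra.ι ℂ i * FreeAlgebra.ι ℂ i) (FreeAlgebra.ι ℂ i)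
  | braid (i j : Gen n) (h : j.1 = i.1 + 1) :
      Rel n (FreeAlgebra.ι ℂ i * FreeAlgebra.ι ℂ j * FreeAlgebra.ι ℂ i)
        (FreeAlgebra.ι ℂ j * FreeAlgebra.ι ℂ i * FreeAlgebra.ι ℂ j)
  | comm (i j : Gen n) (h : i.1 + 2 ≤ j.1 ∨ j.1 + 2 ≤ i.1) :
      Rel n (FreeAlgebra.ι ℂ i * FreeAlgebra.ι ℂ j) (FreeAlgebra.ι ℂ j * FreeAlgebra.ι ℂ i)

/-- The 0-Hecke algebra `H_n(0)` over `ℂ`, given by generators and relations. -/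
def H (n : ℕ) : Type := RingQuot (Rel n)

instance (n : ℕ) : Ring (H n) := inferInstanceAs (Ring (RingQuot (Rel n)))

instance (n : ℕ) : Algebra ℂ (H n) := inferInstanceAs (Algebra ℂ (RingQuot (Rel n)))

/-- The generator `π_i`, for `1 ≤ i ≤ n - 1`. -/
def gen {n : ℕ} (i : Gen n) : H n := RingQuot.mkAlgHom ℂ (Rel n) (FreeAlgebra.ι ℂ i)

/-- The generator `π_i` for a natural number `i` with `1 ≤ i ≤ n - 1`
(and the arbitrary value `1` for the other `i`, which do not occur below). -/
def piNat (n i : ℕ) : H n := if h : 1 ≤ i ∧ i + 1 ≤ n then gen ⟨i, h⟩ else 1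

/-- `π_{[a, b]} = π_a π_{a + 1} ⋯ π_b`. -/
def piInterval (n a b : ℕ) : H n := ((List.range' a (b + 1 - a)).map (piNat n)).prod

/-- The simple transposition `s_i = (i  i+1)`. -/
def simpleTransposition {n : ℕ} (i : Gen n) : Equiv.Perm (Entry n) := Equiv.swap i.lo i.hi

/-- `w` is a reduced expression of the permutation `σ`. -/
def IsReducedExpression {n : ℕ} (w : List (Gen n)) (σ : Equiv.Perm (Entry n)) : Prop :=
  (w.map simpleTransposition).prod = σ ∧
    ∀ w' : List (Gen n), (w'.map simpleTransposition).prod = σ → w.length ≤ w'.length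

/-- `h` is the element `π_σ` of `H_n(0)`, the product of the generators along a reduced
expression of `σ` (it is the same for all reduced expressions). -/
def IsPiPerm {n : ℕ} (σ : Equiv.Perm (Entry n)) (h : H n) : Prop :=
  ∃ w : List (Gen n), IsReducedExpression w σ ∧ h = (w.map gen).prod

/-- Operators that satisfy the defining relations give a representation of `H_n(0)`. -/
def rep {n : ℕ} {M : Type} [AddCommGroup M] [Module ℂ M] (op : Gen n → Module.End ℂ M)
    (idem : ∀ i, op i * op i = op i)
    (braid : ∀ i j : Gen n, j.1 = i.1 + 1 → op i * op j * op i = op j * op i * op j)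
    (comm : ∀ i j : Gen n, (i.1 + 2 ≤ j.1 ∨ j.1 + 2 ≤ i.1) → op i * op j = op j * op i) :
    H n →ₐ[ℂ] Module.End ℂ M :=
  RingQuot.liftAlgHom ℂ ⟨FreeAlgebra.lift ℂ op, by
    intro x y h
    cases h with
    | idem i => simpa using idem i
    | braid i j h => simpa using braid i j h
    | comm i j h => simpa using comm i j h⟩

theorem rep_gen {n : ℕ} {M : Type} [AddCommGroup M] [Module ℂ M] (op : Gen n → Module.End ℂ M)
    (idem : ∀ i, op i * op i = op i)
    (braid : ∀ i j : Gen n, j.1 = i.1 + 1 → op i * op j * op i = op j * op i * op j)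
    (comm : ∀ i j : Gen n, (i.1 + 2 ≤ j.1 ∨ j.1 + 2 ≤ i.1) → op i * op j = op j * op i)
    (i : Gen n) : rep op idem braid comm (gen i) = op i := by
  unfold rep gen
  erw [RingQuot.liftAlgHom_mkAlgHom_apply]
  simp

/-! ### Partial maps on a basis, extended linearly -/

/-- The linear operator on the span of `X` with `T ↦ p T`, where `none` stands for `0`. -/
def linOp {X : Type} (p : X → Option X) : Module.End ℂ (X →₀ ℂ) :=
  Finsupp.lsum ℂ fun T => LinearMap.toSpanSingleton ℂ (X →₀ ℂ)
    ((p T).elim 0 fun T' => Finsupp.single T' 1)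

theorem linOp_single {X : Type} (p : X → Option X) (T : X) :
    linOp p (Finsupp.single T 1) = (p T).elim 0 fun T' => Finsupp.single T' 1 := by
  simp [linOp]

theorem linOp_elim {X : Type} (p : X → Option X) (o : Option X) :
    linOp p (o.elim 0 fun T' => Finsupp.single T' 1)
      = (o.bind p).elim 0 fun T' => Finsupp.single T' 1 := by
  cases o with
  | none => simp
  | some T => simp [linOp_single]

theorem linOp_mul {X : Type} (p q : X → Option X) :
    linOp p * linOp q = linOp fun T => (q T).bind p := by
  apply Finsupp.lhom_ext'
  intro T
  apply LinearMap.ext_ring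
  simp [linOp_single, linOp_elim]

/-! ### Sorting operators on all fillings (used only to verify the relations) -/

section Sorting

open Classical in
/-- Swap the letters `x` and `y` of the filling `T` if their boxes are related by `D`,
unless they are related by `Z`, in which case the result is `0`. -/
def sortStep {C E : Type} [DecidableEq E] (D Z : C → C → Prop) (x y : E) (T : C ≃ E) : Option (C ≃ E) :=
  if D (T.symm x) (T.symm y) then
    if Z (T.symm x) (T.symm y) then none else some (T.trans (Equiv.swap x y))
  else some T

theorem sortStep_idem {C E : Type} [DecidableEq E] (D Z : C → C → Prop)
    (asymm : ∀ a b, D a b → ¬ D b a) (x y : E) (T : C ≃ E) :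
    (sortStep D Z x y T).bind (sortStep D Z x y) = sortStep D Z x y T := by
  classical
  unfold sortStep
  split_ifs with h1 h2
  · rfl
  · have := asymm _ _ h1
    simp [this]
  · simp [h1]

theorem sortStep_trans_swap {C E : Type} [DecidableEq E] (D Z : C → C → Prop) (x y u v : E)
    (hxu : x ≠ u) (hxv : x ≠ v) (hyu : y ≠ u) (hyv : y ≠ v) (T : C ≃ E) :
    sortStep D Z u v (T.trans (Equiv.swap x y))
      = (sortStep D Z u v T).map fun S => S.trans (Equiv.swap x y) := by
  classical
  have e : (T.trans (Equiv.swap x y)).trans (Equiv.swap u v)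
      = (T.trans (Equiv.swap u v)).trans (Equiv.swap x y) := by
    ext a
    simp only [Equiv.trans_apply, Equiv.swap_apply_def]
    grind
  have eu : (T.trans (Equiv.swap x y)).symm u = T.symm u := by
    simp [Equiv.swap_apply_of_ne_of_ne hxu.symm hyu.symm]
  have ev : (T.trans (Equiv.swap x y)).symm v = T.symm v := by
    simp [Equiv.swap_apply_of_ne_of_ne hxv.symm hyv.symm]
  unfold sortStep
  rw [eu, ev, e]
  split_ifs <;> rfl

theorem sortStep_comm {C E : Type} [DecidableEq E] (D Z : C → C → Prop) (x y u v : E)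
    (hxu : x ≠ u) (hxv : x ≠ v) (hyu : y ≠ u) (hyv : y ≠ v) (T : C ≃ E) :
    (sortStep D Z x y T).bind (sortStep D Z u v)
      = (sortStep D Z u v T).bind (sortStep D Z x y) := by
  classical
  have h1 := sortStep_trans_swap D Z x y u v hxu hxv hyu hyv T
  have h2 := sortStep_trans_swap D Z u v x y hxu.symm hyu.symm hxv.symm hyv.symm T
  have e : (T.trans (Equiv.swap x y)).trans (Equiv.swap u v)
      = (T.trans (Equiv.swap u v)).trans (Equiv.swap x y) := by
    ext a
    simp only [Equiv.trans_apply, Equiv.swap_apply_def]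
    grind
  have c1 : sortStep D Z x y T = none ∨ sortStep D Z x y T = some T ∨
      sortStep D Z x y T = some (T.trans (Equiv.swap x y)) := by
    unfold sortStep
    split_ifs <;> simp
  have c2 : sortStep D Z u v T = none ∨ sortStep D Z u v T = some T ∨
      sortStep D Z u v T = some (T.trans (Equiv.swap u v)) := by
    unfold sortStep
    split_ifs <;> simp
  rcases c1 with c1 | c1 | c1 <;> rcases c2 with c2 | c2 | c2 <;>
    simp only [c1, c2, h1, h2, e, Option.bind_some, Option.bind_none, Option.map_some,
      Option.map_none]

theorem sortStep_braid {C E : Type} [DecidableEq E] (D Z : C → C → Prop)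
    (asymm : ∀ a b, D a b → ¬ D b a)
    (neg_trans : ∀ a b c, ¬ D a b → ¬ D b c → ¬ D a c)
    (trans : ∀ a b c, D a b → D b c → D a c) (x y z : E)
    (hxy : x ≠ y) (hxz : x ≠ z) (hyz : y ≠ z) (T : C ≃ E) :
    ((sortStep D Z x y T).bind (sortStep D Z y z)).bind (sortStep D Z x y)
      = ((sortStep D Z y z T).bind (sortStep D Z x y)).bind (sortStep D Z y z) := by
  classical
  have e : ((T.trans (Equiv.swap x y)).trans (Equiv.swap y z)).trans (Equiv.swap x y)
      = ((T.trans (Equiv.swap y z)).trans (Equiv.swap x y)).trans (Equiv.swap y z) := by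
    ext a
    simp only [Equiv.trans_apply, Equiv.swap_apply_def]
    grind
  have t1 := trans (T.symm x) (T.symm y) (T.symm z)
  have t2 := neg_trans (T.symm x) (T.symm y) (T.symm z)
  have a1 := asymm (T.symm x) (T.symm y)
  have a2 := asymm (T.symm y) (T.symm z)
  have n1 : Equiv.swap x y z = z := Equiv.swap_apply_of_ne_of_ne hxz.symm hyz.symm
  have n2 : Equiv.swap y z x = x := Equiv.swap_apply_of_ne_of_ne hxy hxz
  clear asymm neg_trans trans
  by_cases h1 : D (T.symm x) (T.symm y) <;> by_cases h2 : D (T.symm y) (T.symm z) <;>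
    by_cases h3 : D (T.symm x) (T.symm z)
  all_goals
    first
    | exact absurd h3 (t2 h1 h2)
    | exact absurd (t1 h1 h2) h3
    | simp only [h1, h2, forall_const, false_implies] at a1 a2
  all_goals
    by_cases k1 : Z (T.symm x) (T.symm y) <;> by_cases k2 : Z (T.symm y) (T.symm z) <;>
    by_cases k3 : Z (T.symm x) (T.symm z) <;>
    simp [sortStep, h1, h2, h3, k1, k2, k3, n1, n2, e, a1, a2]

/-- Relations between partial maps can be checked after an embedding. -/
theorem bind_map_of_map {X Y : Type} (ι : X → Y) {p : X → Option X} {P : Y → Option Y}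
    (hp : ∀ T, (p T).map ι = P (ι T)) (o : Option X) : (o.bind p).map ι = (o.map ι).bind P := by
  cases o with
  | none => rfl
  | some T => simpa using hp T

end Sorting

theorem step_relations {n : ℕ} {C X : Type} (D Z : C → C → Prop)
    (asymm : ∀ a b, D a b → ¬ D b a)
    (neg_trans : ∀ a b c, ¬ D a b → ¬ D b c → ¬ D a c)
    (trans : ∀ a b c, D a b → D b c → D a c)
    (ι : X → (C ≃ Entry n)) (inj : Function.Injective ι) (p : Gen n → X → Option X)
    (hp : ∀ i T, (p i T).map ι = sortStep D Z i.lo i.hi (ι T)) :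
    (∀ i, linOp (p i) * linOp (p i) = linOp (p i)) ∧
    (∀ i j : Gen n, j.1 = i.1 + 1 →
      linOp (p i) * linOp (p j) * linOp (p i) = linOp (p j) * linOp (p i) * linOp (p j)) ∧
    (∀ i j : Gen n, (i.1 + 2 ≤ j.1 ∨ j.1 + 2 ≤ i.1) →
      linOp (p i) * linOp (p j) = linOp (p j) * linOp (p i)) := by
  refine ⟨fun i => ?_, fun i j hij => ?_, fun i j hij => ?_⟩
  · rw [linOp_mul]
    congr 1
    funext T
    apply Option.map_injective inj
    have := sortStep_idem D Z asymm i.lo i.hi (ι T)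
    rw [bind_map_of_map ι (hp i), hp, this]
  · simp only [linOp_mul]
    congr 1
    funext T
    apply Option.map_injective inj
    simp only [← Option.bind_assoc, bind_map_of_map ι (hp i), bind_map_of_map ι (hp j), hp]
    have hh : j.lo = i.hi := Subtype.ext hij
    rw [hh]
    apply sortStep_braid D Z asymm neg_trans trans <;>
      · intro h
        have := congrArg Subtype.val h
        simp only [Gen.lo, Gen.hi] at this
        omega
  · simp only [linOp_mul]
    congr 1
    funext T
    apply Option.map_injective inj
    simp only [bind_map_of_map ι (hp i), bind_map_of_map ι (hp j), hp]
    apply sortStep_comm D Z <;>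
      · intro h
        have := congrArg Subtype.val h
        simp only [Gen.lo, Gen.hi] at this
        omega

/-! ### Compositions, diagrams, fillings -/

/-- `set(α) = {α₁, α₁ + α₂, …, α₁ + ⋯ + α_{ℓ(α) - 1}}`. -/
def compSet {n : ℕ} (α : Composition n) : Set ℕ :=
  {k | ∃ i : ℕ, 1 ≤ i ∧ i < α.length ∧ k = α.sizeUpTo i}

/-- `I(α) = {1 ≤ i ≤ ℓ(α) - 1 ∣ α_{i+1} ≠ 1}`.  The parts are indexed from `0` by `blocksFun`,
so `α_{i+1}` is the part of index `i`. -/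
def calI {n : ℕ} (α : Composition n) : Set ℕ :=
  {i | 1 ≤ i ∧ ∃ h : i < α.length, α.blocksFun ⟨i, h⟩ ≠ 1}

/-- The boxes of the diagrams attached to `α`: the pairs `⟨i, j⟩` with `i` the index of a part
and `j < α_i`, both counted from `0`.  In the composition diagram, `⟨i, j⟩` is the box in row `i`
(from the top) and column `j`; in the ribbon diagram, it is the box of column `i` (from the left)
that is the `j`th from the top of that column. -/
abbrev Box {n : ℕ} (α : Composition n) : Type := Σ i : Fin α.length, Fin (α.blocksFun i)

/-- The row of a box of the ribbon diagram, rows being numbered downwards (from an arbitrary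
origin).  The bottom box of column `i + 1` lies in the row of the top box of column `i`. -/
def ribbonRow {n : ℕ} {α : Composition n} (x : Box α) : ℤ :=
  (x.2.1 : ℤ) + (x.1.1 + 1) - α.sizeUpTo (x.1.1 + 1)

/-- The fillings of a diagram of `α` with the letters `1, …, n`, each used once. -/
abbrev Filling {n : ℕ} (α : Composition n) : Type := Box α ≃ Entry n

/-- `s_i · T`: the letters `i` and `i + 1` are exchanged. -/
def Filling.swap {n : ℕ} {α : Composition n} (T : Filling α) (i : Gen n) : Filling α :=
  T.trans (Equiv.swap i.lo i.hi)

/-! ### Standard ribbon tableaux and the module `P_α` -/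

/-- Rows increase from left to right and columns increase from top to bottom in the
ribbon diagram. -/
def IsSRT {n : ℕ} {α : Composition n} (T : Filling α) : Prop :=
  (∀ x y : Box α, ribbonRow x = ribbonRow y → x.1 < y.1 → T x < T y) ∧
    (∀ x y : Box α, x.1 = y.1 → ribbonRow x < ribbonRow y → T x < T y)

/-- The standard ribbon tableaux of shape `α`. -/
abbrev SRT {n : ℕ} (α : Composition n) : Type := {T : Filling α // IsSRT T}

/-- The descents of a standard ribbon tableau: `i` is weakly below `i + 1`. -/
def SRT.Des {n : ℕ} {α : Composition n} (T : SRT α) : Set (Gen n) :=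
  {i | ribbonRow (T.1.symm i.hi) ≤ ribbonRow (T.1.symm i.lo)}

theorem lt_swap_iff {n : ℕ} (i : Gen n) {a b : Entry n} (hab : a < b)
    (h : ¬ (a = i.lo ∧ b = i.hi)) : Equiv.swap i.lo i.hi a < Equiv.swap i.lo i.hi b := by
  obtain ⟨a, ha⟩ := a
  obtain ⟨b, hb⟩ := b
  obtain ⟨i, hi⟩ := i
  simp only [Gen.lo, Gen.hi, Equiv.swap_apply_def, Subtype.mk.injEq, Subtype.mk_lt_mk] at *
  split_ifs <;> simp <;> omega

theorem SRT.isSRT_swap {n : ℕ} {α : Composition n} (T : SRT α) (i : Gen n)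
    (h : ribbonRow (T.1.symm i.hi) < ribbonRow (T.1.symm i.lo)) : IsSRT (T.1.swap i) := by
  refine ⟨fun x y hr hc => ?_, fun x y hc hr => ?_⟩
  · refine lt_swap_iff i (T.2.1 x y hr hc) ?_
    rintro ⟨h1, h2⟩
    rw [← h1, ← h2] at h
    simp [hr] at h
  · refine lt_swap_iff i (T.2.2 x y hc hr) ?_
    rintro ⟨h1, h2⟩
    rw [← h1, ← h2] at h
    simp at h
    omega

open Classical in
/-- The action of `π_i` on a standard ribbon tableau `T`: it is `T` if `i` is not a descent, `0`
(written `none`) if `i` and `i + 1` are in the same row, and `s_i · T` if `i` is strictly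
below `i + 1`. -/
def SRT.step {n : ℕ} {α : Composition n} (i : Gen n) (T : SRT α) : Option (SRT α) :=
  if hd : i ∈ T.Des then
    if hr : ribbonRow (T.1.symm i.lo) = ribbonRow (T.1.symm i.hi) then none
    else some ⟨T.1.swap i, T.isSRT_swap i (lt_of_le_of_ne hd (Ne.symm hr))⟩
  else some T

theorem SRT.step_relations {n : ℕ} (α : Composition n) :
    (∀ i : Gen n, linOp (SRT.step (α := α) i) * linOp (SRT.step i) = linOp (SRT.step i)) ∧
    (∀ i j : Gen n, j.1 = i.1 + 1 →
      linOp (SRT.step (α := α) i) * linOp (SRT.step j) * linOp (SRT.step i)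
        = linOp (SRT.step j) * linOp (SRT.step i) * linOp (SRT.step j)) ∧
    (∀ i j : Gen n, (i.1 + 2 ≤ j.1 ∨ j.1 + 2 ≤ i.1) →
      linOp (SRT.step (α := α) i) * linOp (SRT.step j)
        = linOp (SRT.step j) * linOp (SRT.step i)) := by
  classical
  refine ZeroHecke.step_relations (C := Box α)
    (fun a b => ribbonRow b < ribbonRow a ∨ (ribbonRow b = ribbonRow a ∧ a.1 < b.1))
    (fun a b => ribbonRow a = ribbonRow b) ?_ ?_ ?_ (fun T : SRT α => T.1)
    Subtype.val_injective SRT.step ?_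
  · intro a b h
    omega
  · intro a b c h h'
    omega
  · intro a b c h h'
    omega
  · intro i T
    have key : ribbonRow (T.1.symm i.hi) = ribbonRow (T.1.symm i.lo) →
        (T.1.symm i.lo).1 < (T.1.symm i.hi).1 := by
      intro h
      have hlt : i.lo < i.hi := by simp [Gen.lo, Gen.hi]
      rcases lt_trichotomy (T.1.symm i.lo).1 (T.1.symm i.hi).1 with h1 | h1 | h1
      · exact h1
      · exfalso
        have h2 : T.1.symm i.lo = T.1.symm i.hi := by
          generalize T.1.symm i.lo = x at h h1
          generalize T.1.symm i.hi = y at h h1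
          obtain ⟨x1, x2⟩ := x
          obtain ⟨y1, y2⟩ := y
          simp only at h1
          subst h1
          simp only [ribbonRow] at h
          congr 1
          apply Fin.ext
          omega
        have := T.1.symm.injective h2
        rw [this] at hlt
        exact lt_irrefl _ hlt
      · exfalso
        have := T.2.1 _ _ h h1
        simp only [Equiv.apply_symm_apply] at this
        exact lt_asymm hlt this
    unfold SRT.step sortStep
    simp only [SRT.Des, Set.mem_ofPred_eq]
    by_cases h1 : ribbonRow (T.1.symm i.hi) < ribbonRow (T.1.symm i.lo)
    · simp only [h1, h1.le, h1.ne', dite_true, dite_false, if_true, if_false, true_or]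
      rfl
    · by_cases h2 : ribbonRow (T.1.symm i.hi) = ribbonRow (T.1.symm i.lo)
      · simp [h2, key h2]
      · have h3 : ¬ ribbonRow (T.1.symm i.hi) ≤ ribbonRow (T.1.symm i.lo) := by omega
        simp [h1, h2, h3]

/-- The `ℂ`-vector space `P_α` with basis the standard ribbon tableaux of shape `α`. -/
def P {n : ℕ} (α : Composition n) : Type := SRT α →₀ ℂ

instance {n : ℕ} (α : Composition n) : AddCommGroup (P α) :=
  inferInstanceAs (AddCommGroup (SRT α →₀ ℂ))

instance {n : ℕ} (α : Composition n) : Module ℂ (P α) :=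
  inferInstanceAs (Module ℂ (SRT α →₀ ℂ))

/-- The representation of `H_n(0)` on `P_α`. -/
def P.rep {n : ℕ} (α : Composition n) : H n →ₐ[ℂ] Module.End ℂ (P α) :=
  ZeroHecke.rep (M := SRT α →₀ ℂ) (fun i => linOp (SRT.step i))
    (SRT.step_relations α).1 (SRT.step_relations α).2.1 (SRT.step_relations α).2.2

/-- The `H_n(0)`-module `P_α`. -/
instance {n : ℕ} (α : Composition n) : Module (H n) (P α) :=
  Module.compHom (P α) (P.rep α).toRingHom

instance {n : ℕ} (α : Composition n) : IsScalarTower ℂ (H n) (P α) :=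
  ⟨fun c h v => by
    change P.rep α (c • h) v = c • P.rep α h v
    rw [map_smul]
    rfl⟩

/-- The basis vector of `P_α` given by a standard ribbon tableau. -/
def P.basisVec {n : ℕ} {α : Composition n} (T : SRT α) : P α := (Finsupp.single T 1 : SRT α →₀ ℂ)

theorem P.gen_smul_basisVec {n : ℕ} {α : Composition n} (i : Gen n) (T : SRT α) :
    gen i • P.basisVec T = (SRT.step i T).elim 0 P.basisVec := by
  change P.rep α (gen i) (P.basisVec T) = _
  unfold P.rep
  erw [rep_gen]
  exact linOp_single _ _

/-- The filling of the boxes with `1, …, n` in the order "part after part". -/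
def sourceFilling {n : ℕ} (α : Composition n) : Filling α :=
  α.blocksFinEquiv.trans
    { toFun := fun k => ⟨k.1 + 1, by omega, k.2⟩
      invFun := fun k => ⟨k.1 - 1, by have := k.2; omega⟩
      left_inv := fun k => by simp
      right_inv := fun k => by
        apply Subtype.ext
        have := k.2
        simp only
        omega }

theorem sourceFilling_val {n : ℕ} (α : Composition n) (x : Box α) :
    (sourceFilling α x).1 = α.sizeUpTo x.1.1 + x.2.1 + 1 := rfl

/-- The source tableau `T_α`: the ribbon diagram filled with `1, …, n` from top to bottom and
from left to right. -/
def sourceSRT {n : ℕ} (α : Composition n) : SRT α :=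
  ⟨sourceFilling α, by
    refine ⟨fun x y _ hc => ?_, fun x y hc hr => ?_⟩
    · rw [← Subtype.coe_lt_coe, sourceFilling_val, sourceFilling_val]
      have h1 : α.sizeUpTo (x.1.1 + 1) ≤ α.sizeUpTo y.1.1 := α.monotone_sizeUpTo hc
      have h2 := α.sizeUpTo_succ' x.1
      have h3 := x.2.2
      omega
    · rw [← Subtype.coe_lt_coe, sourceFilling_val, sourceFilling_val]
      simp only [ribbonRow, hc] at hr ⊢
      omega⟩

/-! ### Standard immaculate tableaux and the module `V_α` -/

/-- The rows increase from left to right, and the first column increases from top to bottom. -/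
def IsSIT {n : ℕ} {α : Composition n} (T : Filling α) : Prop :=
  (∀ x y : Box α, x.1 = y.1 → x.2.1 < y.2.1 → T x < T y) ∧
    (∀ x y : Box α, x.2.1 = 0 → y.2.1 = 0 → x.1 < y.1 → T x < T y)

/-- The standard immaculate tableaux of shape `α`. -/
abbrev SIT {n : ℕ} (α : Composition n) : Type := {T : Filling α // IsSIT T}

instance {n : ℕ} (α : Composition n) : Finite (SIT α) :=
  haveI : Finite (Entry n) := Set.finite_Icc 1 n
  inferInstanceAs (Finite {T : Filling α // IsSIT T})

/-- `i` is a descent of a standard immaculate tableau: `i` is strictly above `i + 1`. -/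
def SIT.IsDescent {n : ℕ} {α : Composition n} (T : SIT α) (i : Gen n) : Prop :=
  (T.1.symm i.lo).1 < (T.1.symm i.hi).1

/-- The descent set of a standard immaculate tableau, as a set of natural numbers. -/
def SIT.Des {n : ℕ} {α : Composition n} (T : SIT α) : Set ℕ :=
  {k | ∃ i : Gen n, i.1 = k ∧ T.IsDescent i}

theorem SIT.isSIT_swap {n : ℕ} {α : Composition n} (T : SIT α) (i : Gen n)
    (hd : T.IsDescent i) (hc : ¬ ((T.1.symm i.lo).2.1 = 0 ∧ (T.1.symm i.hi).2.1 = 0)) :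
    IsSIT (T.1.swap i) := by
  refine ⟨fun x y hr hxy => ?_, fun x y hx hy hxy => ?_⟩
  · refine lt_swap_iff i (T.2.1 x y hr hxy) ?_
    rintro ⟨h1, h2⟩
    unfold SIT.IsDescent at hd
    rw [← h1, ← h2] at hd
    simp [hr] at hd
  · refine lt_swap_iff i (T.2.2 x y hx hy hxy) ?_
    rintro ⟨h1, h2⟩
    apply hc
    have e1 : T.1.symm i.lo = x := by rw [← h1, Equiv.symm_apply_apply]
    have e2 : T.1.symm i.hi = y := by rw [← h2, Equiv.symm_apply_apply]
    rw [e1, e2]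
    exact ⟨hx, hy⟩

open Classical in
/-- The action of `π_i` on a standard immaculate tableau `T`: it is `T` if `i` is not a descent,
`0` (written `none`) if `i` and `i + 1` are in the first column, and `s_i · T` otherwise. -/
def SIT.step {n : ℕ} {α : Composition n} (i : Gen n) (T : SIT α) : Option (SIT α) :=
  if hd : T.IsDescent i then
    if hc : (T.1.symm i.lo).2.1 = 0 ∧ (T.1.symm i.hi).2.1 = 0 then none
    else some ⟨T.1.swap i, T.isSIT_swap i hd hc⟩
  else some T

theorem SIT.step_relations {n : ℕ} (α : Composition n) :
    (∀ i : Gen n, linOp (SIT.step (α := α) i) * linOp (SIT.step i) = linOp (SIT.step i)) ∧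
    (∀ i j : Gen n, j.1 = i.1 + 1 →
      linOp (SIT.step (α := α) i) * linOp (SIT.step j) * linOp (SIT.step i)
        = linOp (SIT.step j) * linOp (SIT.step i) * linOp (SIT.step j)) ∧
    (∀ i j : Gen n, (i.1 + 2 ≤ j.1 ∨ j.1 + 2 ≤ i.1) →
      linOp (SIT.step (α := α) i) * linOp (SIT.step j)
        = linOp (SIT.step j) * linOp (SIT.step i)) := by
  classical
  refine ZeroHecke.step_relations (C := Box α) (fun a b => a.1 < b.1)
    (fun a b => a.2.1 = 0 ∧ b.2.1 = 0) ?_ ?_ ?_ (fun T : SIT α => T.1)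
    Subtype.val_injective SIT.step ?_
  · intro a b h
    exact lt_asymm h
  · intro a b c h h'
    exact not_lt.2 ((not_lt.1 h').trans (not_lt.1 h))
  · intro a b c h h'
    exact h.trans h'
  · intro i T
    unfold SIT.step sortStep SIT.IsDescent
    split_ifs <;> rfl

/-- The `ℂ`-vector space `V_α` with basis the standard immaculate tableaux of shape `α`. -/
def V {n : ℕ} (α : Composition n) : Type := SIT α →₀ ℂ

instance {n : ℕ} (α : Composition n) : AddCommGroup (V α) :=
  inferInstanceAs (AddCommGroup (SIT α →₀ ℂ))

instance {n : ℕ} (α : Composition n) : Module ℂ (V α) :=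
  inferInstanceAs (Module ℂ (SIT α →₀ ℂ))

/-- The representation of `H_n(0)` on `V_α`. -/
def V.rep {n : ℕ} (α : Composition n) : H n →ₐ[ℂ] Module.End ℂ (V α) :=
  ZeroHecke.rep (M := SIT α →₀ ℂ) (fun i => linOp (SIT.step i))
    (SIT.step_relations α).1 (SIT.step_relations α).2.1 (SIT.step_relations α).2.2

/-- The `H_n(0)`-module `V_α`. -/
instance {n : ℕ} (α : Composition n) : Module (H n) (V α) :=
  Module.compHom (V α) (V.rep α).toRingHom

instance {n : ℕ} (α : Composition n) : IsScalarTower ℂ (H n) (V α) :=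
  ⟨fun c h v => by
    change V.rep α (c • h) v = c • V.rep α h v
    rw [map_smul]
    rfl⟩

/-- The basis vector of `V_α` given by a standard immaculate tableau. -/
def V.basisVec {n : ℕ} {α : Composition n} (T : SIT α) : V α := (Finsupp.single T 1 : SIT α →₀ ℂ)

/-- The coordinates of a vector of `V_α` in the basis of standard immaculate tableaux. -/
def V.coords {n : ℕ} {α : Composition n} (v : V α) : SIT α →₀ ℂ := v

theorem V.gen_smul_basisVec {n : ℕ} {α : Composition n} (i : Gen n) (T : SIT α) :
    gen i • V.basisVec T = (SIT.step i T).elim 0 V.basisVec := by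
  change V.rep α (gen i) (V.basisVec T) = _
  unfold V.rep
  erw [rep_gen]
  exact linOp_single _ _

/-! ### Homomorphisms from `P_α` to `V_β` -/

/-- The order `τ' ≼ τ` on standard immaculate tableaux: `τ' = π_γ · τ` for some permutation `γ`. -/
def SIT.RevLE {n : ℕ} {β : Composition n} (τ' τ : SIT β) : Prop :=
  ∃ (γ : Equiv.Perm (Entry n)) (h : H n), IsPiPerm γ h ∧ V.basisVec τ' = h • V.basisVec τ

/-- A linear order on the standard immaculate tableaux of shape `β` is a linear extension
of `≼`. -/
def IsLinearExtension {n : ℕ} {β : Composition n} (L : LinearOrder (SIT β)) : Prop :=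
  ∀ τ' τ : SIT β, SIT.RevLE τ' τ → L.le τ' τ

/-- The coefficient `c_{f,T}` of `T` in `f(T_α)`. -/
def coeff {n : ℕ} {α β : Composition n} (f : P α →ₗ[H n] V β) (T : SIT β) : ℂ :=
  (f (P.basisVec (sourceSRT α))).coords T

/-- `Lead(f)`: the largest tableau (for the order `L`) with a nonzero coefficient in `f(T_α)`;
it is `⊥` if there is none. -/
def lead {n : ℕ} {α β : Composition n} (L : LinearOrder (SIT β)) (f : P α →ₗ[H n] V β) :
    WithBot (SIT β) :=
  Finset.max (f (P.basisVec (sourceSRT α))).coords.support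

/-- The set `𝔅` of standard immaculate tableaux `U` of shape `β` with `Des(U) = set(α)`. -/
abbrev B {n : ℕ} (α β : Composition n) : Type := {U : SIT β // U.Des = compSet α}

instance {n : ℕ} (α β : Composition n) : Fintype (B α β) := Fintype.ofFinite _

/-- `f` has leading tableau `U`, coefficient `1` at `U`, and coefficient `0` at the other
elements of `𝔅`. -/
def IsHomWithLead {n : ℕ} {α β : Composition n} (L : LinearOrder (SIT β)) (U : B α β)
    (f : P α →ₗ[H n] V β) : Prop :=
  lead L f = (U.1 : WithBot (SIT β)) ∧ coeff f U.1 = 1 ∧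
    ∀ U' : B α β, U' ≠ U → coeff f U'.1 = 0

/-- The space of coefficient vectors `(c_U)` with
`∑_U c_U π_{[m_{i-1} + 1, m_i]} · f_U(T_α) = 0` for all `i ∈ I(α)`,
where `m_i = α₁ + ⋯ + α_i`. -/
def coeffSpace {n : ℕ} {α β : Composition n} (f : B α β → (P α →ₗ[H n] V β)) :
    Submodule ℂ (B α β → ℂ) where
  carrier := {c | ∀ i ∈ calI α,
    ∑ U : B α β, c U • (piInterval n (α.sizeUpTo (i - 1) + 1) (α.sizeUpTo i) •
      f U (P.basisVec (sourceSRT α))) = 0}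
  zero_mem' := by
    intro i _
    simp
  add_mem' := by
    intro c d hc hd i hi
    simp only [Pi.add_apply, add_smul, Finset.sum_add_distrib]
    rw [hc i hi, hd i hi, add_zero]
  smul_mem' := by
    intro a c hc i hi
    simp only [Pi.smul_apply, smul_assoc, ← Finset.smul_sum]
    rw [hc i hi, smul_zero]

end ZeroHecke

end

/-!
The argument compares `P_α` and `V_β` through leading coefficients.

*Leading tableaux.*  With respect to a linear extension of `≼` the generators act triangularly on
`V_β`, and `π_i` multiplies the coefficient of the largest tableau `U` by `0` if `i` is a descent
of `U` and by `1` otherwise (`SupportedBelow.coords_gen_smul`).  Since `π_i · T_α = T_α` for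
`i ∉ set(α)`, and since moving part `j` of `T_α` past part `j + 1` ends in `0`, the leading tableau
of a nonzero homomorphism has descent set `set(α)` (`des_eq_compSet_of_leading`).  As `T_α`
generates `P_α` (`P.hom_eq_zero`), a homomorphism is determined by its coefficients at `𝔅`
(`coeffMap_injective`).

*Existence.*  Conversely, `U ∈ 𝔅` is the leading tableau of a homomorphism.  All fillings of the
ribbon span the regular representation, in which `P_α` is embedded by antisymmetrizing over the
rows of the ribbon (`gen_smul_antisymmetrized_eq`).  The regular representation is free, so it maps
to `V_β` with generator going to `U`; concretely, a filling goes to the product of generators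
along any reduced expression, which is well defined by the diamond argument `sorted_of_drop`.  In
the image of `T_α` only the identity contributes to the coefficient of `U`
(`exists_hom_leading`).  So the coefficients at `𝔅` of these homomorphisms form a unitriangular
matrix, and `Hom(P_α, V_β)` is isomorphic to `ℂ^𝔅`, which gives part (a).

*Homomorphisms out of `V_α`.*  A standard immaculate tableau, read as a filling of the ribbon, is a
standard ribbon tableau, and killing the other ribbon tableaux is a homomorphism `P_α → V_α`
(`projection`).  Its kernel is generated by the vectors `π_{[m_{i-1} + 1, m_i]} · T_α` with
`i ∈ I(α)` (`projection_piInterval_smul`, `exists_comp_projection_of_piInterval`), so composition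
with the projection identifies `Hom(V_α, V_β)` with the coefficient space of part (b)
(`range_coeffMapProjection`).
-/

noncomputable section

namespace ZeroHecke

/-! ### Linear maps that commute with the generators -/

theorem H.induction {n : ℕ} {p : H n → Prop} (algebraMap : ∀ c : ℂ, p (algebraMap ℂ (H n) c))
    (gen : ∀ i, p (gen i)) (mul : ∀ a b, p a → p b → p (a * b))
    (add : ∀ a b, p a → p b → p (a + b)) (h : H n) : p h := by
  obtain ⟨x, rfl⟩ := RingQuot.mkAlgHom_surjective ℂ (Rel n) h
  induction x using FreeAlgebra.induction with
  | grade0 c =>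
    rw [AlgHom.commutes]
    exact algebraMap c
  | grade1 i => exact gen i
  | mul a b ha hb => rw [map_mul]; exact mul _ _ ha hb
  | add a b ha hb => rw [map_add]; exact add _ _ ha hb

section Hom

variable {n : ℕ} {M N : Type*} [AddCommGroup M] [Module ℂ M] [Module (H n) M]
  [IsScalarTower ℂ (H n) M] [AddCommGroup N] [Module ℂ N] [Module (H n) N]
  [IsScalarTower ℂ (H n) N]

/-- A `ℂ`-linear map that commutes with the generators of `H_n(0)` is `H_n(0)`-linear. -/
def homOfGen (f : M →ₗ[ℂ] N) (hf : ∀ (i : Gen n) v, f (gen i • v) = gen i • f v) :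
    M →ₗ[H n] N where
  toFun := f
  map_add' := f.map_add
  map_smul' h := by
    simp only [RingHom.id_apply]
    induction h using H.induction with
    | algebraMap c => intro v; simp only [algebraMap_smul, map_smul]
    | gen i => exact hf i
    | mul a b ha hb => intro v; rw [mul_smul, ha, hb, mul_smul]
    | add a b ha hb => intro v; rw [add_smul, map_add, ha, hb, add_smul]

end Hom

variable {n : ℕ} {α β : Composition n}

theorem P.induction {p : P α → Prop} (zero : p 0) (add : ∀ v w, p v → p w → p (v + w))
    (smul : ∀ (c : ℂ) T, p (c • P.basisVec T)) (v : P α) : p v := by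
  refine Finsupp.induction_linear (v : SRT α →₀ ℂ) zero add fun T c => ?_
  have := smul c T
  rwa [show c • P.basisVec T = (Finsupp.single T c : SRT α →₀ ℂ) from
    Finsupp.smul_single_one T c] at this

/-- The `ℂ`-linear map out of `P_α` with prescribed images of the basis vectors. -/
def P.linearOfBasis {M : Type*} [AddCommGroup M] [Module ℂ M] (g : SRT α → M) : P α →ₗ[ℂ] M :=
  (Finsupp.linearCombination ℂ g : (SRT α →₀ ℂ) →ₗ[ℂ] M)

theorem P.linearOfBasis_basisVec {M : Type*} [AddCommGroup M] [Module ℂ M] (g : SRT α → M)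
    (T : SRT α) : P.linearOfBasis g (P.basisVec T) = g T := by
  change Finsupp.linearCombination ℂ g (Finsupp.single T 1) = g T
  rw [Finsupp.linearCombination_single, one_smul]

section HomOfBasis

variable {M : Type*} [AddCommGroup M] [Module ℂ M] [Module (H n) M] [IsScalarTower ℂ (H n) M]

/-- The homomorphism out of `P_α` with prescribed images of the basis vectors. -/
def P.homOfBasis (g : SRT α → M) (hg : ∀ i T, gen i • g T = (SRT.step i T).elim 0 g) :
    P α →ₗ[H n] M :=
  homOfGen (P.linearOfBasis g) (by
    intro i v
    induction v using P.induction with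
    | zero => simp only [smul_zero, map_zero]
    | add v w hv hw => rw [smul_add, map_add, map_add, smul_add, hv, hw]
    | smul c T =>
      rw [smul_comm (gen i) c, map_smul, map_smul _ c (P.basisVec T), smul_comm (gen i) c,
        P.linearOfBasis_basisVec, P.gen_smul_basisVec, hg]
      cases SRT.step i T with
      | none => simp only [Option.elim_none, map_zero]
      | some T' => simp only [Option.elim_some, P.linearOfBasis_basisVec])

theorem P.homOfBasis_basisVec (g : SRT α → M)
    (hg : ∀ i T, gen i • g T = (SRT.step i T).elim 0 g) (T : SRT α) :
    P.homOfBasis g hg (P.basisVec T) = g T :=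
  P.linearOfBasis_basisVec g T

theorem P.hom_ext {f g : P α →ₗ[H n] M} (h : ∀ T, f (P.basisVec T) = g (P.basisVec T)) :
    f = g := by
  ext v
  induction v using P.induction with
  | zero => rw [map_zero, map_zero]
  | add v w hv hw => rw [map_add, map_add, hv, hw]
  | smul c T => rw [LinearMap.map_smul_of_tower, LinearMap.map_smul_of_tower, h]

end HomOfBasis

/-! ### Fillings -/

theorem Filling.swap_apply_val (T : Filling α) (i : Gen n) (b : Box α) :
    ((T.swap i b).1 : ℤ) = (T b).1 + (if b = T.symm i.lo then 1 else 0)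
      - (if b = T.symm i.hi then 1 else 0) := by
  simp only [Filling.swap, Equiv.trans_apply, Equiv.swap_apply_def, Equiv.eq_symm_apply]
  by_cases h1 : T b = i.lo
  · have h2 : i.lo ≠ i.hi := by simp [Gen.lo, Gen.hi]
    simp [h1, h2]; simp [Gen.lo, Gen.hi]
  · by_cases h2 : T b = i.hi
    · have h3 : i.hi ≠ i.lo := by simp [Gen.lo, Gen.hi]
      simp [h2, h3]; simp [Gen.lo, Gen.hi]
    · simp [h1, h2]

@[simp] theorem Filling.swap_symm_lo (T : Filling α) (i : Gen n) :
    (T.swap i).symm i.lo = T.symm i.hi := by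
  simp [Filling.swap]

@[simp] theorem Filling.swap_symm_hi (T : Filling α) (i : Gen n) :
    (T.swap i).symm i.hi = T.symm i.lo := by
  simp [Filling.swap]

@[simp] theorem Filling.swap_swap (T : Filling α) (i : Gen n) : (T.swap i).swap i = T := by
  ext b
  simp [Filling.swap]

theorem Gen.lo_lt_hi (i : Gen n) : i.lo < i.hi := by
  simp [Gen.lo, Gen.hi]

theorem Gen.lo_ne_hi (i : Gen n) : i.lo ≠ i.hi := i.lo_lt_hi.ne

/-- The sum of the entries of `T`, each weighted by its box.  It is the measure along which
fillings are sorted by exchanges of consecutive letters. -/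
def energy (p : Box α → ℕ) (T : Filling α) : ℕ := ∑ b, p b * (T b).1

theorem energy_swap_lt (p : Box α → ℕ) (T : Filling α) (i : Gen n)
    (h : p (T.symm i.lo) < p (T.symm i.hi)) : energy p (T.swap i) < energy p T := by
  have : (energy p (T.swap i) : ℤ) = energy p T + p (T.symm i.lo) - p (T.symm i.hi) := by
    simp only [energy, Nat.cast_sum, Nat.cast_mul, Filling.swap_apply_val, mul_sub, mul_add,
      Finset.sum_add_distrib, Finset.sum_sub_distrib, mul_ite, mul_one, mul_zero,
      Finset.sum_ite_eq', Finset.mem_univ, if_true]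
  omega

/-- Two fillings agree if the second increases along the letters of the first. -/
theorem Filling.eq_of_lt (T S : Filling α) (h : ∀ i : Gen n, S (T.symm i.lo) < S (T.symm i.hi)) :
    T = S := by
  have lower : ∀ k (hk : 1 ≤ k ∧ k ≤ n), k ≤ (S (T.symm ⟨k, hk⟩)).1 := by
    intro k
    induction k with
    | zero => intro hk; omega
    | succ k ih =>
      intro hk
      by_cases h0 : 1 ≤ k
      · have h1 := ih ⟨h0, by omega⟩
        have h2 := h ⟨k, h0, hk.2⟩
        simp only [Gen.lo, Gen.hi, ← Subtype.coe_lt_coe] at h2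
        omega
      · have := (S (T.symm ⟨k + 1, hk⟩)).2.1
        omega
  have upper : ∀ d k (hk : 1 ≤ k ∧ k ≤ n), d = n - k → (S (T.symm ⟨k, hk⟩)).1 ≤ k := by
    intro d
    induction d with
    | zero =>
      intro k hk hd
      have := (S (T.symm ⟨k, hk⟩)).2.2
      omega
    | succ d ih =>
      intro k hk hd
      have h1 := ih (k + 1) ⟨by omega, by omega⟩ (by omega)
      have h2 := h ⟨k, hk.1, by omega⟩
      simp only [Gen.lo, Gen.hi, ← Subtype.coe_lt_coe] at h2
      omega
  ext b
  have h1 := lower _ (T b).2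
  have h2 := upper _ _ (T b).2 rfl
  simp only [Subtype.coe_eta, Equiv.symm_apply_apply] at h1 h2
  omega

/-! ### Ribbon rows -/

theorem sizeUpTo_add_le {i j : ℕ} (hij : i ≤ j) (hj : j ≤ α.length) :
    α.sizeUpTo i + (j - i) ≤ α.sizeUpTo j := by
  induction j, hij using Nat.le_induction with
  | base => simp
  | succ j hij ih =>
    have h1 := ih (by omega)
    have h2 := α.sizeUpTo_strict_mono (i := j) (by omega)
    omega

/-- The ribbon climbs from left to right: a box strictly to the right of `x` lies weakly
above `x`, and in the row of `x` only if `x` is the top box of its column. -/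
theorem ribbonRow_add_le {x y : Box α} (h : x.1 < y.1) :
    ribbonRow y + x.2.1 ≤ ribbonRow x := by
  have h1 := sizeUpTo_add_le (α := α) (i := x.1.1 + 1) (j := y.1.1) h y.1.2.le
  have h2 := α.sizeUpTo_succ' y.1
  have h3 := y.2.2
  have h4 : x.1.1 < y.1.1 := h
  simp only [ribbonRow]
  omega

theorem ribbonRow_lt_iff {x y : Box α} (h : x.1 = y.1) :
    ribbonRow x < ribbonRow y ↔ x.2.1 < y.2.1 := by
  simp only [ribbonRow, h]
  omega

theorem Box.ext {x y : Box α} (h1 : x.1 = y.1) (h2 : x.2.1 = y.2.1) : x = y := by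
  obtain ⟨x1, x2⟩ := x
  obtain ⟨y1, y2⟩ := y
  simp only at h1
  subst h1
  congr 1
  exact Fin.ext h2

/-- In a standard ribbon tableau the descents can be read off the columns. -/
theorem SRT.mem_Des_iff (T : SRT α) (i : Gen n) :
    i ∈ T.Des ↔ (T.1.symm i.lo).1 < (T.1.symm i.hi).1 := by
  have hlt := i.lo_lt_hi
  have hr := T.2.1 (T.1.symm i.hi) (T.1.symm i.lo)
  have hc := T.2.2 (T.1.symm i.hi) (T.1.symm i.lo)
  simp only [Equiv.apply_symm_apply] at hr hc
  simp only [SRT.Des, Set.mem_ofPred_eq]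
  rcases lt_trichotomy (T.1.symm i.lo).1 (T.1.symm i.hi).1 with h | h | h
  · have := ribbonRow_add_le h
    simp only [h, iff_true]
    omega
  · simp only [h, lt_irrefl, iff_false, not_le]
    by_contra hcon
    have hne : T.1.symm i.hi ≠ T.1.symm i.lo := fun e => i.lo_ne_hi (T.1.symm.injective e).symm
    rcases lt_or_eq_of_le (not_lt.1 hcon) with h' | h'
    · exact lt_asymm hlt (hc h.symm h')
    · refine hne (Box.ext h.symm ?_)
      simp only [ribbonRow, h] at h'
      omega
  · have h1 := ribbonRow_add_le h
    simp only [not_lt.2 h.le, iff_false, not_le]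
    refine lt_of_le_of_ne (by omega) fun e => lt_asymm hlt (hr e.symm h)

/-- Undoing an exchange: if `i + 1` lies in a column to the left of `i`, then `T` is the image
under `π_i` of a standard ribbon tableau. -/
theorem SRT.exists_swap (T : SRT α) (i : Gen n) (h : (T.1.symm i.hi).1 < (T.1.symm i.lo).1) :
    ∃ T' : SRT α, T'.1 = T.1.swap i ∧ gen i • P.basisVec T' = P.basisVec T := by
  have hs : IsSRT (T.1.swap i) := by
    refine ⟨fun x y hr hc => ?_, fun x y hc hr => ?_⟩
    · refine lt_swap_iff i (T.2.1 x y hr hc) ?_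
      rintro ⟨h1, h2⟩
      rw [← h1, ← h2] at h
      simp only [Equiv.symm_apply_apply] at h
      exact lt_asymm h hc
    · refine lt_swap_iff i (T.2.2 x y hc hr) ?_
      rintro ⟨h1, h2⟩
      rw [← h1, ← h2] at h
      simp [hc] at h
  refine ⟨⟨_, hs⟩, rfl, ?_⟩
  have hd : i ∈ SRT.Des ⟨_, hs⟩ := (SRT.mem_Des_iff _ i).2 (by simpa using h)
  have hr : ¬ ribbonRow ((T.1.swap i).symm i.lo) = ribbonRow ((T.1.swap i).symm i.hi) := by
    intro e
    simp only [Filling.swap_symm_lo, Filling.swap_symm_hi] at e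
    have := T.2.1 _ _ e h
    simp only [Equiv.apply_symm_apply] at this
    exact lt_asymm i.lo_lt_hi this
  rw [P.gen_smul_basisVec]
  unfold SRT.step
  rw [dif_pos hd, dif_neg hr]
  simp

theorem SRT.lt_of_snd_lt (T : SRT α) {x y : Box α} (h1 : x.1 = y.1) (h2 : x.2.1 < y.2.1) :
    T.1 x < T.1 y :=
  T.2.2 x y h1 ((ribbonRow_lt_iff h1).2 h2)

theorem SRT.snd_lt_of_lt (T : SRT α) {x y : Box α} (h1 : x.1 = y.1) (h2 : T.1 x < T.1 y) :
    x.2.1 < y.2.1 := by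
  by_contra hcon
  rcases lt_or_eq_of_le (not_lt.1 hcon) with h | h
  · exact lt_asymm h2 (T.lt_of_snd_lt h1.symm h)
  · rw [Box.ext h1 h.symm] at h2
    exact lt_irrefl _ h2

/-- Induction along exchanges: a property may be proved for `T` from the tableaux `T'` with
`T = π_i · T' ≠ T'`. -/
theorem SRT.induction_swap {p : SRT α → Prop}
    (h : ∀ T : SRT α, (∀ T' : SRT α, ∀ i : Gen n, (T.1.symm i.hi).1 < (T.1.symm i.lo).1 →
      T'.1 = T.1.swap i → gen i • P.basisVec T' = P.basisVec T → p T') → p T) (T : SRT α) :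
    p T := by
  let w : Box α → ℕ := fun b => α.length - b.1.1
  have main : ∀ (N : ℕ) (T : SRT α), energy w T.1 = N → p T := by
    intro N
    induction N using Nat.strong_induction_on with
    | _ N ih =>
      intro T hT
      refine h T fun T' i hi hT' _ => ih (energy w T'.1) ?_ T' rfl
      rw [hT', ← hT]
      apply energy_swap_lt
      have h1 := (T.1.symm i.lo).1.2
      have h2 : (T.1.symm i.hi).1.1 < (T.1.symm i.lo).1.1 := hi
      simp only [w]
      omega
  exact main _ T rfl

theorem sourceFilling_lt_of_fst_lt {x y : Box α} (h : x.1 < y.1) :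
    sourceFilling α x < sourceFilling α y := by
  rw [← Subtype.coe_lt_coe, sourceFilling_val, sourceFilling_val]
  have h1 : α.sizeUpTo (x.1.1 + 1) ≤ α.sizeUpTo y.1.1 := α.monotone_sizeUpTo h
  have h2 := α.sizeUpTo_succ' x.1
  have h3 := x.2.2
  omega

theorem sourceFilling_lt_of_snd_lt {x y : Box α} (h1 : x.1 = y.1) (h2 : x.2.1 < y.2.1) :
    sourceFilling α x < sourceFilling α y := by
  rw [← Subtype.coe_lt_coe, sourceFilling_val, sourceFilling_val]
  simp only [h1]
  omega

/-- The source tableau generates `P_α`. -/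
theorem P.hom_eq_zero {M : Type*} [AddCommGroup M] [Module ℂ M] [Module (H n) M]
    [IsScalarTower ℂ (H n) M] (f : P α →ₗ[H n] M) (hf : f (P.basisVec (sourceSRT α)) = 0) :
    f = 0 := by
  have key : ∀ T : SRT α, f (P.basisVec T) = 0 := by
    intro T
    induction T using SRT.induction_swap with
    | h T ih =>
      by_cases hT : ∃ i : Gen n, (T.1.symm i.hi).1 < (T.1.symm i.lo).1
      · obtain ⟨i, hi⟩ := hT
        obtain ⟨T', h1, h2⟩ := T.exists_swap i hi
        rw [← h2, map_smul, ih T' i hi h1 h2, smul_zero]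
      · push Not at hT
        have : T = sourceSRT α := by
          refine Subtype.ext (Filling.eq_of_lt _ _ fun i => ?_)
          rcases lt_or_eq_of_le (hT i) with h | h
          · exact sourceFilling_lt_of_fst_lt h
          · refine sourceFilling_lt_of_snd_lt h (T.snd_lt_of_lt h ?_)
            simpa using i.lo_lt_hi
        rw [this, hf]
  exact P.hom_ext key

/-! ### Triangularity of the action on standard immaculate tableaux -/

theorem V.coords_gen_smul_apply (i : Gen n) (v : V β) (T : SIT β) :
    (gen i • v).coords T = v.coords.sum fun S c => open Classical in
      c * if SIT.step i S = some T then 1 else 0 := by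
  classical
  have h : gen i • v = linOp (SIT.step i) v := by
    change V.rep β (gen i) v = _
    unfold V.rep
    erw [rep_gen]
    rfl
  rw [h]
  change (linOp (SIT.step i) v.coords) T = _
  unfold linOp
  rw [Finsupp.lsum_apply, Finsupp.sum_apply]
  refine Finsupp.sum_congr fun S _ => ?_
  cases SIT.step i S with
  | none => simp
  | some S' => simp [Finsupp.single_apply]

theorem V.coords_smul (c : ℂ) (v : V β) : (c • v).coords = c • v.coords := rfl

theorem V.coords_sum {ι : Type*} (s : Finset ι) (v : ι → V β) :
    (∑ a ∈ s, v a).coords = ∑ a ∈ s, (v a).coords :=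
  map_sum (LinearMap.id : (SIT β →₀ ℂ) →ₗ[ℂ] (SIT β →₀ ℂ)) v s

theorem V.coords_basisVec (U : SIT β) : (V.basisVec U).coords = Finsupp.single U 1 := rfl

theorem simpleTransposition_ne_one (i : Gen n) : simpleTransposition i ≠ 1 := by
  intro h
  have := congrArg (fun σ => σ i.lo) h
  simp only [simpleTransposition, Equiv.swap_apply_left, Equiv.Perm.coe_one, id] at this
  exact i.lo_ne_hi this.symm

theorem SIT.revLE_of_step {i : Gen n} {S T : SIT β} (h : SIT.step i S = some T) :
    SIT.RevLE T S := by
  refine ⟨simpleTransposition i, gen i, ⟨[i], ⟨by simp, fun w hw => ?_⟩, by simp⟩, ?_⟩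
  · rcases w with _ | ⟨a, w⟩
    · simp only [List.map_nil, List.prod_nil] at hw
      exact absurd hw.symm (simpleTransposition_ne_one i)
    · simp
  · rw [V.gen_smul_basisVec, h, Option.elim_some]

theorem SIT.step_eq_self_iff (i : Gen n) (T : SIT β) :
    SIT.step i T = some T ↔ ¬ T.IsDescent i := by
  unfold SIT.step
  split_ifs with hd hc
  · simp [hd]
  · simp only [Option.some.injEq, hd, not_true, iff_false]
    intro h
    have h1 := congrArg (fun S : SIT β => S.1.symm i.lo) h
    simp only [Filling.swap_symm_lo] at h1
    exact i.lo_ne_hi (T.1.symm.injective h1).symm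
  · simp [hd]

/-- All tableaux that occur in `v` are at most `U`. -/
def SupportedBelow (L : LinearOrder (SIT β)) (U : SIT β) (v : V β) : Prop :=
  ∀ T, v.coords T ≠ 0 → L.le T U

section Triangular

variable {L : LinearOrder (SIT β)} {U : SIT β} {v : V β}

theorem SupportedBelow.gen_smul (hL : IsLinearExtension L) (hv : SupportedBelow L U v)
    (i : Gen n) : SupportedBelow L U (gen i • v) := by
  intro T hT
  rw [V.coords_gen_smul_apply] at hT
  obtain ⟨S, hS, hne⟩ := Finset.exists_ne_zero_of_sum_ne_zero hT
  dsimp only at hne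
  split_ifs at hne with h
  · exact L.le_trans _ _ _ (hL _ _ (SIT.revLE_of_step h)) (hv S (by simpa using hS))
  · simp at hne

/-- The generators act on leading coefficients through a character. -/
theorem SupportedBelow.coords_gen_smul (hL : IsLinearExtension L) (hv : SupportedBelow L U v)
    (i : Gen n) :
    (gen i • v).coords U = open Classical in if U.IsDescent i then 0 else v.coords U := by
  classical
  rw [V.coords_gen_smul_apply]
  have : ∀ S, v.coords S ≠ 0 → S ≠ U → SIT.step i S ≠ some U := by
    intro S hS hne h
    exact hne (L.le_antisymm _ _ (hv S hS) (hL _ _ (SIT.revLE_of_step h)))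
  rw [Finsupp.sum, Finset.sum_eq_single U]
  · simp only [SIT.step_eq_self_iff]
    split_ifs <;> simp_all
  · intro S hS hne
    rw [if_neg (this S (by simpa using hS) hne), mul_zero]
  · intro h
    simp only [Finsupp.mem_support_iff, not_not] at h
    simp [h]

end Triangular

/-! ### The leading tableau of a homomorphism -/

theorem sourceFilling_symm_bounds (k : Entry n) :
    α.sizeUpTo ((sourceFilling α).symm k).1.1 < k.1 ∧
      k.1 ≤ α.sizeUpTo (((sourceFilling α).symm k).1.1 + 1) := by
  have h1 := sourceFilling_val α ((sourceFilling α).symm k)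
  rw [Equiv.apply_symm_apply] at h1
  have h2 := α.sizeUpTo_succ' ((sourceFilling α).symm k).1
  have h3 := ((sourceFilling α).symm k).2.2
  omega

theorem lt_of_sizeUpTo_lt {i j : ℕ} (h : α.sizeUpTo i < α.sizeUpTo j) : i < j := by
  by_contra hcon
  exact absurd (α.monotone_sizeUpTo (not_lt.1 hcon)) (not_le.2 h)

/-- The descents of the source tableau are the elements of `set(α)`. -/
theorem sourceFilling_symm_fst_lt_iff (i : Gen n) :
    ((sourceFilling α).symm i.lo).1 < ((sourceFilling α).symm i.hi).1 ↔ i.1 ∈ compSet α := by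
  have h1 := sourceFilling_symm_bounds (α := α) i.lo
  have h2 := sourceFilling_symm_bounds (α := α) i.hi
  generalize (sourceFilling α).symm i.lo = x at *
  generalize (sourceFilling α).symm i.hi = y at *
  simp only [Gen.lo, Gen.hi] at h1 h2
  constructor
  · intro h
    have h3 : α.sizeUpTo (x.1.1 + 1) ≤ α.sizeUpTo y.1.1 := α.monotone_sizeUpTo h
    have h4 : x.1.1 < y.1.1 := h
    exact ⟨x.1.1 + 1, by omega, by have := y.1.2; omega, by omega⟩
  · rintro ⟨j, -, -, hj⟩
    have h3 : x.1.1 < j := lt_of_sizeUpTo_lt (α := α) (by omega)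
    have h4 : j < y.1.1 + 1 := lt_of_sizeUpTo_lt (α := α) (by omega)
    exact Fin.lt_def.2 (by omega)

theorem gen_smul_sourceSRT {i : Gen n} (hi : i.1 ∉ compSet α) :
    gen i • P.basisVec (sourceSRT α) = P.basisVec (sourceSRT α) := by
  rw [P.gen_smul_basisVec]
  unfold SRT.step
  rw [dif_neg, Option.elim_some]
  rw [SRT.mem_Des_iff]
  exact fun h => hi ((sourceFilling_symm_fst_lt_iff i).1 h)

theorem SRT.step_of_mem_Des {T : SRT α} {i : Gen n} (h : i ∈ T.Des) :
    SRT.step i T = none ∨ ∃ T' : SRT α, T'.1 = T.1.swap i ∧ SRT.step i T = some T' := by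
  unfold SRT.step
  rw [dif_pos h]
  split_ifs with hr
  · exact Or.inl rfl
  · exact Or.inr ⟨_, rfl, rfl⟩

/-- Between a letter and a later letter in a column further to the right there is a descent. -/
theorem SRT.exists_descent (T : SRT α) {x y : Box α} (h : x.1 < y.1) (hT : T.1 x < T.1 y) :
    ∃ i ∈ T.Des, (T.1 x).1 ≤ i.1 ∧ i.1 < (T.1 y).1 := by
  by_contra! hcon
  have key : ∀ k (hk : 1 ≤ k ∧ k ≤ n), (T.1 x).1 ≤ k → k ≤ (T.1 y).1 →
      (T.1.symm ⟨k, hk⟩).1 ≤ x.1 := by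
    intro k hk hxk
    induction k, hxk using Nat.le_induction with
    | base => intro _; simp
    | succ k hxk ih =>
      intro hky
      have hx := (T.1 x).2.1
      have h1 := ih ⟨by omega, by omega⟩ (by omega)
      let i : Gen n := ⟨k, by omega, hk.2⟩
      have h2 : i ∉ T.Des := fun hi => by
        have := hcon i hi hxk
        simp only [i] at this
        omega
      rw [SRT.mem_Des_iff, not_lt] at h2
      exact h2.trans h1
  have := key _ (T.1 y).2 hT.le le_rfl
  simp only [Subtype.coe_eta, Equiv.symm_apply_apply] at this
  exact absurd h (not_lt.2 this)

theorem swap_mem_Ioc {i : Gen n} {a b : ℕ} (ha : a < i.1) (hb : i.1 < b) {k : Entry n}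
    (hk : a < k.1 ∧ k.1 ≤ b) :
    a < (Equiv.swap i.lo i.hi k).1 ∧ (Equiv.swap i.lo i.hi k).1 ≤ b := by
  simp only [Equiv.swap_apply_def]
  split_ifs <;> first | omega | (simp only [Gen.lo, Gen.hi]; omega)

/-- The leading tableau of a homomorphism has descent set `set(α)`.  For `m_j ∈ set(α)`, the
source tableau is moved by the generators `π_i` with `m_{j-1} < i < m_{j+1}`.  The top box of
column `j` and the bottom box of column `j + 1` lie in one row, so this ends in `0`.  If `m_j` were
not a descent of the leading tableau, the leading coefficient would never change on the way. -/
theorem des_eq_compSet_of_leading {L : LinearOrder (SIT β)} (hL : IsLinearExtension L)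
    (f : P α →ₗ[H n] V β) (U : SIT β) (hU : coeff f U ≠ 0)
    (hmax : SupportedBelow L U (f (P.basisVec (sourceSRT α)))) : U.Des = compSet α := by
  classical
  have sub : ∀ i : Gen n, U.IsDescent i → i.1 ∈ compSet α := by
    intro i hi
    by_contra hcon
    have h1 := hmax.coords_gen_smul hL i
    rw [← map_smul, gen_smul_sourceSRT hcon, if_pos hi] at h1
    exact hU h1
  refine Set.Subset.antisymm ?_ ?_
  · rintro k ⟨i, rfl, hi⟩
    exact sub i hi
  rintro k ⟨j, hj1, hj2, rfl⟩
  by_contra hnd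
  have nd : ∀ i : Gen n, α.sizeUpTo (j - 1) < i.1 → i.1 < α.sizeUpTo (j + 1) →
      ¬ U.IsDescent i := by
    intro i h1 h2 hi
    obtain ⟨j', -, -, hj'⟩ := sub i hi
    have h3 : j - 1 < j' := lt_of_sizeUpTo_lt (α := α) (by omega)
    have h4 : j' < j + 1 := lt_of_sizeUpTo_lt (α := α) (by omega)
    have h5 : j' = j := by omega
    subst h5
    exact hnd ⟨i, hj', hi⟩
  let x : Box α := ⟨⟨j - 1, by omega⟩, ⟨0, α.one_le_blocksFun _⟩⟩
  let y : Box α := ⟨⟨j, hj2⟩, ⟨α.blocksFun ⟨j, hj2⟩ - 1, by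
    have := α.one_le_blocksFun ⟨j, hj2⟩; omega⟩⟩
  have hxy : x.1 < y.1 := Fin.lt_def.2 (by simp only [x, y]; omega)
  have hrow : ribbonRow x = ribbonRow y := by
    have h1 := α.sizeUpTo_succ' ⟨j, hj2⟩
    have h2 := α.one_le_blocksFun ⟨j, hj2⟩
    have h3 : j - 1 + 1 = j := by omega
    simp only [ribbonRow, x, y, h3] at h1 ⊢
    omega
  let p : Box α → ℕ := fun b => b.1.1
  have main : ∀ (N : ℕ) (T : SRT α), energy p T.1 = N →
      (α.sizeUpTo (j - 1) < (T.1 x).1 ∧ (T.1 x).1 ≤ α.sizeUpTo (j + 1)) →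
      (α.sizeUpTo (j - 1) < (T.1 y).1 ∧ (T.1 y).1 ≤ α.sizeUpTo (j + 1)) →
      (f (P.basisVec T)).coords U ≠ 0 → ¬ SupportedBelow L U (f (P.basisVec T)) := by
    intro N
    induction N using Nat.strong_induction_on with
    | _ N ih =>
      intro T hN hx hy hne hsup
      obtain ⟨i, hi, hi1, hi2⟩ := T.exists_descent hxy (T.2.1 x y hrow hxy)
      have hia : α.sizeUpTo (j - 1) < i.1 := by omega
      have hib : i.1 < α.sizeUpTo (j + 1) := by omega
      have hc := hsup.coords_gen_smul hL i
      have hs := hsup.gen_smul hL i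
      rw [if_neg (nd i hia hib)] at hc
      rw [← map_smul, P.gen_smul_basisVec] at hc hs
      rcases SRT.step_of_mem_Des hi with h | ⟨T', hT', h⟩
      · rw [h, Option.elim_none, map_zero] at hc
        exact hne hc.symm
      · rw [h, Option.elim_some] at hc hs
        refine ih (energy p T'.1) ?_ T' rfl ?_ ?_ (hc ▸ hne) hs
        · rw [hT', ← hN]
          exact energy_swap_lt p T.1 i ((T.mem_Des_iff i).1 hi)
        · rw [hT']
          exact swap_mem_Ioc hia hib hx
        · rw [hT']
          exact swap_mem_Ioc hia hib hy
  have hm1 := α.sizeUpTo_strict_mono (i := j - 1) (by omega)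
  have hm2 := α.sizeUpTo_strict_mono hj2
  have e : j - 1 + 1 = j := by omega
  rw [e] at hm1
  refine main _ (sourceSRT α) rfl ?_ ?_ hU hmax
  · have := sourceFilling_val α x
    change α.sizeUpTo (j - 1) < (sourceFilling α x).1 ∧
      (sourceFilling α x).1 ≤ α.sizeUpTo (j + 1)
    simp only [x] at this
    simp only [x, this]
    omega
  · have := sourceFilling_val α y
    have h1 := α.sizeUpTo_succ' ⟨j, hj2⟩
    have h2 := α.one_le_blocksFun ⟨j, hj2⟩
    change α.sizeUpTo (j - 1) < (sourceFilling α y).1 ∧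
      (sourceFilling α y).1 ≤ α.sizeUpTo (j + 1)
    simp only [y] at this h1
    simp only [y, this]
    omega

/-- A nonzero homomorphism has a leading tableau, which lies in `𝔅`. -/
theorem exists_leading {L : LinearOrder (SIT β)} (hL : IsLinearExtension L)
    (f : P α →ₗ[H n] V β) (hf : f ≠ 0) :
    ∃ U : B α β, lead L f = (U.1 : WithBot (SIT β)) ∧ coeff f U.1 ≠ 0 := by
  have hne : (f (P.basisVec (sourceSRT α))).coords.support.Nonempty := by
    rw [Finset.nonempty_iff_ne_empty, Ne, Finsupp.support_eq_empty]
    exact fun h => hf (P.hom_eq_zero f h)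
  let _ := L
  obtain ⟨U, hU⟩ := Finset.max_of_nonempty hne
  have hmem := Finset.mem_of_max hU
  have hc : coeff f U ≠ 0 := Finsupp.mem_support_iff.1 hmem
  refine ⟨⟨U, des_eq_compSet_of_leading hL f U hc fun T hT => ?_⟩, hU, hc⟩
  exact Finset.le_max_of_eq (Finsupp.mem_support_iff.2 hT) hU

/-! ### Sorting fillings by the generators -/

theorem gen_mul_self (i : Gen n) : gen i * gen i = gen i := by
  have := RingQuot.mkAlgHom_rel ℂ (Rel.idem i)
  rwa [map_mul] at this

theorem gen_braid {i j : Gen n} (h : j.1 = i.1 + 1) :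
    gen i * gen j * gen i = gen j * gen i * gen j := by
  have := RingQuot.mkAlgHom_rel ℂ (Rel.braid i j h)
  simp only [map_mul] at this
  exact this

theorem gen_comm {i j : Gen n} (h : i.1 + 2 ≤ j.1 ∨ j.1 + 2 ≤ i.1) :
    gen i * gen j = gen j * gen i := by
  have := RingQuot.mkAlgHom_rel ℂ (Rel.comm i j h)
  simp only [map_mul] at this
  exact this

theorem Filling.swap_symm_apply (T : Filling α) (i : Gen n) (x : Entry n) :
    (T.swap i).symm x = T.symm (Equiv.swap i.lo i.hi x) := by
  simp [Filling.swap]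

theorem Filling.swap_comm (T : Filling α) {i j : Gen n} (h : i.1 + 2 ≤ j.1 ∨ j.1 + 2 ≤ i.1) :
    (T.swap i).swap j = (T.swap j).swap i := by
  have h1 : i.lo ≠ j.lo := by simp [Gen.lo]; omega
  have h2 : i.lo ≠ j.hi := by simp [Gen.lo, Gen.hi]; omega
  have h3 : i.hi ≠ j.lo := by simp [Gen.lo, Gen.hi]; omega
  have h4 : i.hi ≠ j.hi := by simp [Gen.hi]; omega
  refine Equiv.ext fun b => ?_
  simp only [Filling.swap, Equiv.trans_apply, Equiv.swap_apply_def]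
  grind

theorem Filling.swap_braid (T : Filling α) {i j : Gen n} (h : j.1 = i.1 + 1) :
    ((T.swap i).swap j).swap i = ((T.swap j).swap i).swap j := by
  have h1 : j.lo = i.hi := Subtype.ext h
  have h2 : i.lo ≠ j.hi := by simp [Gen.lo, Gen.hi]; omega
  have h3 := i.lo_ne_hi
  have h4 := j.lo_ne_hi
  refine Equiv.ext fun b => ?_
  simp only [Filling.swap, Equiv.trans_apply, Equiv.swap_apply_def, h1] at *
  grind

/-- The boxes numbered column by column from left to right, each column from bottom to top. -/
def columnReading (α : Composition n) : Filling α :=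
  (Equiv.sigmaCongrRight fun _ => Fin.revPerm).trans (sourceFilling α)

theorem columnReading_val (x : Box α) :
    (columnReading α x).1 = α.sizeUpTo x.1.1 + (α.blocksFun x.1 - (x.2.1 + 1)) + 1 := by
  have := sourceFilling_val α (⟨x.1, Fin.rev x.2⟩ : Box α)
  simpa [columnReading] using this

theorem sourceFilling_symm_columnReading_fst (x : Box α) :
    ((sourceFilling α).symm (columnReading α x)).1 = x.1 := by
  simp [columnReading]

theorem columnReading_lt_of_fst_lt {x y : Box α} (h : x.1 < y.1) :
    columnReading α x < columnReading α y := by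
  rw [← Subtype.coe_lt_coe, columnReading_val, columnReading_val]
  have h1 : α.sizeUpTo (x.1.1 + 1) ≤ α.sizeUpTo y.1.1 := α.monotone_sizeUpTo h
  have h2 := α.sizeUpTo_succ' x.1
  have h3 := x.2.2
  omega

theorem columnReading_lt_of_ribbonRow_lt {x y : Box α} (h : ribbonRow y < ribbonRow x) :
    columnReading α x < columnReading α y := by
  rcases lt_trichotomy x.1 y.1 with h1 | h1 | h1
  · exact columnReading_lt_of_fst_lt h1
  · have h2 := (ribbonRow_lt_iff h1.symm).1 h
    have h3 := x.2.2
    rw [← Subtype.coe_lt_coe, columnReading_val, columnReading_val]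
    simp only [h1] at h3 ⊢
    omega
  · have := ribbonRow_add_le h1
    omega

/-- The letter `i + 1` precedes the letter `i` in the column reading order of the boxes. -/
def Filling.Drop (T : Filling α) (i : Gen n) : Prop :=
  columnReading α (T.symm i.hi) < columnReading α (T.symm i.lo)

/-- The measure that decreases when a drop is removed. -/
def dropEnergy (T : Filling α) : ℕ := energy (fun b => n - (columnReading α b).1) T

theorem dropEnergy_swap_lt {T : Filling α} {i : Gen n} (h : T.Drop i) :
    dropEnergy (T.swap i) < dropEnergy T := by
  refine energy_swap_lt _ T i ?_
  have h1 := (columnReading α (T.symm i.lo)).2.2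
  have h2 := Subtype.coe_lt_coe.2 h
  omega

theorem Filling.drop_swap {T : Filling α} {i : Gen n} (h : ¬ T.Drop i) : (T.swap i).Drop i := by
  unfold Filling.Drop at *
  rw [Filling.swap_symm_lo, Filling.swap_symm_hi]
  refine lt_of_le_of_ne (not_lt.1 h) fun e => ?_
  exact i.lo_ne_hi (T.symm.injective ((columnReading α).injective e))

section Sorted

variable {M : Type*} [AddCommGroup M] [Module (H n) M]

open Classical in
/-- The vector `π_{i_1} ⋯ π_{i_p} · u`, where `s_{i_1} ⋯ s_{i_p}` is a reduced expression of the
permutation that carries the column reading filling to `T`.  It is computed by removing drops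
one by one, in an arbitrary order. -/
def sorted (u : M) (T : Filling α) : M :=
  if h : ∃ i, T.Drop i then gen h.choose • sorted u (T.swap h.choose) else u
termination_by dropEnergy T
decreasing_by exact dropEnergy_swap_lt h.choose_spec

theorem sorted_of_not_drop (u : M) {T : Filling α} (h : ¬ ∃ i, T.Drop i) : sorted u T = u := by
  rw [sorted, dif_neg h]

/-- The value of `sorted` does not depend on the drop that is removed first.  As in any proof of
Matsumoto's theorem, two drops can be completed to both sides of a defining relation. -/
theorem sorted_of_drop (u : M) (T : Filling α) {i : Gen n} (h : T.Drop i) :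
    sorted u T = gen i • sorted u (T.swap i) := by
  have main : ∀ (N : ℕ) (T : Filling α), dropEnergy T = N → ∀ i, T.Drop i →
      sorted u T = gen i • sorted u (T.swap i) := by
    intro N
    induction N using Nat.strong_induction_on with
    | _ N ih =>
      intro T hN
      have step : ∀ T' : Filling α, dropEnergy T' < dropEnergy T → ∀ i, T'.Drop i →
          sorted u T' = gen i • sorted u (T'.swap i) :=
        fun T' h => ih _ (hN ▸ h) T' rfl
      have far : ∀ i j : Gen n, (i.1 + 2 ≤ j.1 ∨ j.1 + 2 ≤ i.1) → T.Drop i → T.Drop j →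
          gen i • sorted u (T.swap i) = gen j • sorted u (T.swap j) := by
        intro i j hij hi hj
        have h1 : j.lo ≠ i.lo := by simp [Gen.lo]; omega
        have h2 : j.lo ≠ i.hi := by simp [Gen.lo, Gen.hi]; omega
        have h3 : j.hi ≠ i.lo := by simp [Gen.lo, Gen.hi]; omega
        have h4 : j.hi ≠ i.hi := by simp [Gen.hi]; omega
        have hj' : (T.swap i).Drop j := by
          unfold Filling.Drop
          rw [Filling.swap_symm_apply, Filling.swap_symm_apply,
            Equiv.swap_apply_of_ne_of_ne h1 h2, Equiv.swap_apply_of_ne_of_ne h3 h4]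
          exact hj
        have hi' : (T.swap j).Drop i := by
          unfold Filling.Drop
          rw [Filling.swap_symm_apply, Filling.swap_symm_apply,
            Equiv.swap_apply_of_ne_of_ne h1.symm h3.symm,
            Equiv.swap_apply_of_ne_of_ne h2.symm h4.symm]
          exact hi
        rw [step _ (dropEnergy_swap_lt hi) j hj', step _ (dropEnergy_swap_lt hj) i hi',
          ← mul_smul, ← mul_smul, gen_comm hij, Filling.swap_comm T hij]
      have near : ∀ i j : Gen n, j.1 = i.1 + 1 → T.Drop i → T.Drop j →
          gen i • sorted u (T.swap i) = gen j • sorted u (T.swap j) := by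
        intro i j hij hi hj
        have h1 : j.lo = i.hi := Subtype.ext hij
        have h2 : i.lo ≠ j.hi := by simp [Gen.lo, Gen.hi]; omega
        have h3 := i.lo_ne_hi
        have h4 : i.hi ≠ j.hi := h1 ▸ j.lo_ne_hi
        have hlt : columnReading α (T.symm j.hi) < columnReading α (T.symm i.lo) := by
          unfold Filling.Drop at hi hj
          rw [h1] at hj
          exact hj.trans hi
        have e1 : Equiv.swap i.lo i.hi j.hi = j.hi :=
          Equiv.swap_apply_of_ne_of_ne h2.symm h4.symm
        have e2 : Equiv.swap i.hi j.hi i.lo = i.lo := Equiv.swap_apply_of_ne_of_ne h3 h2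
        have d1 : (T.swap i).Drop j := by
          simpa [Filling.Drop, Filling.swap_symm_apply, h1, e1] using hlt
        have d2 : ((T.swap i).swap j).Drop i := by
          unfold Filling.Drop at hj ⊢
          simpa [Filling.swap_symm_apply, h1, e1, e2] using hj
        have d3 : (T.swap j).Drop i := by
          simpa [Filling.Drop, Filling.swap_symm_apply, h1, e2] using hlt
        have d4 : ((T.swap j).swap i).Drop j := by
          unfold Filling.Drop at hi ⊢
          simpa [Filling.swap_symm_apply, h1, e1, e2] using hi
        have l1 := dropEnergy_swap_lt hi
        have l2 := dropEnergy_swap_lt hj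
        rw [step _ l1 j d1, step _ ((dropEnergy_swap_lt d1).trans l1) i d2,
          step _ l2 i d3, step _ ((dropEnergy_swap_lt d3).trans l2) j d4,
          ← mul_smul, ← mul_smul, ← mul_smul, ← mul_smul, gen_braid hij, Filling.swap_braid T hij]
      intro i hi
      have hex : ∃ j, T.Drop j := ⟨i, hi⟩
      rw [sorted, dif_pos hex]
      have hj := hex.choose_spec
      generalize hex.choose = j at hj
      rcases lt_trichotomy i.1 j.1 with h | h | h
      · by_cases h' : j.1 = i.1 + 1
        · exact (near i j h' hi hj).symm
        · exact far j i (by omega) hj hi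
      · rw [Subtype.ext h]
      · by_cases h' : i.1 = j.1 + 1
        · exact near j i h' hj hi
        · exact far j i (by omega) hj hi
  exact main _ T rfl i h

theorem gen_smul_sorted_of_drop (u : M) {T : Filling α} {i : Gen n} (h : T.Drop i) :
    gen i • sorted u T = sorted u T := by
  rw [sorted_of_drop u T h, ← mul_smul, gen_mul_self]

theorem gen_smul_sorted_of_not_drop (u : M) {T : Filling α} {i : Gen n} (h : ¬ T.Drop i) :
    gen i • sorted u T = sorted u (T.swap i) := by
  rw [sorted_of_drop u _ (Filling.drop_swap h), Filling.swap_swap]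

theorem gen_smul_sorted_swap (u : M) (T : Filling α) (i : Gen n) :
    gen i • sorted u (T.swap i) = gen i • sorted u T := by
  by_cases h : T.Drop i
  · rw [gen_smul_sorted_of_drop u h, sorted_of_drop u T h]
  · rw [gen_smul_sorted_of_not_drop u h, gen_smul_sorted_of_drop u (Filling.drop_swap h)]

/-! ### Antisymmetrizing over the rows of the ribbon -/

open Classical in
/-- The permutations of the boxes of the ribbon that preserve every row. -/
def rowStabilizer (α : Composition n) : Finset (Equiv.Perm (Box α)) :=
  {w | ∀ b, ribbonRow (w b) = ribbonRow b}

theorem mem_rowStabilizer {w : Equiv.Perm (Box α)} :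
    w ∈ rowStabilizer α ↔ ∀ b, ribbonRow (w b) = ribbonRow b := by
  simp [rowStabilizer]

/-- The signed sum of `sorted u` over the row class of the filling `T` of the ribbon. -/
def antisymmetrized (u : M) (T : Filling α) : M :=
  ∑ w ∈ rowStabilizer α, (Equiv.Perm.sign w : ℤ) • sorted u (w.trans T)

theorem ribbonRow_symm {w : Equiv.Perm (Box α)} (hw : w ∈ rowStabilizer α) (b : Box α) :
    ribbonRow (w.symm b) = ribbonRow b := by
  have := mem_rowStabilizer.1 hw (w.symm b)
  rwa [Equiv.apply_symm_apply, eq_comm] at this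

theorem gen_smul_antisymmetrized (u : M) (T : Filling α) (i : Gen n) :
    gen i • antisymmetrized u T = ∑ w ∈ rowStabilizer α,
      (Equiv.Perm.sign w : ℤ) • gen i • sorted u (w.trans T) := by
  unfold antisymmetrized
  rw [Finset.smul_sum]
  exact Finset.sum_congr rfl fun w _ => smul_comm _ _ _

/-- Antisymmetrization over the rows turns the regular representation into `P_α`. -/
theorem gen_smul_antisymmetrized_eq (u : M) (T : SRT α) (i : Gen n) :
    gen i • antisymmetrized u T.1
      = (SRT.step i T).elim 0 fun T' => antisymmetrized u T'.1 := by
  classical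
  rw [gen_smul_antisymmetrized]
  rcases lt_trichotomy (ribbonRow (T.1.symm i.lo)) (ribbonRow (T.1.symm i.hi)) with h | h | h
  · have hd : i ∉ T.Des := not_le.2 h
    unfold SRT.step
    rw [dif_neg hd, Option.elim_some]
    refine Finset.sum_congr rfl fun w hw => ?_
    rw [gen_smul_sorted_of_drop]
    refine columnReading_lt_of_ribbonRow_lt ?_
    simpa only [Equiv.symm_trans_apply, ribbonRow_symm hw] using h
  · have hd : i ∈ T.Des := h.ge
    unfold SRT.step
    rw [dif_pos hd, dif_pos h, Option.elim_none]
    -- The letters `i` and `i + 1` lie in one row: exchanging them pairs off the summands.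
    let t : Equiv.Perm (Box α) := Equiv.swap (T.1.symm i.lo) (T.1.symm i.hi)
    have hne : T.1.symm i.lo ≠ T.1.symm i.hi := fun e => i.lo_ne_hi (T.1.symm.injective e)
    have ht : ∀ b, ribbonRow (t b) = ribbonRow b := by
      intro b
      simp only [t, Equiv.swap_apply_def]
      split_ifs with h1 h2
      · rw [h1, h]
      · rw [h2, h]
      · rfl
    have hsign : Equiv.Perm.sign t = -1 := Equiv.Perm.sign_swap hne
    have hswap : ∀ w : Equiv.Perm (Box α),
        ((w.trans t).trans T.1 : Filling α) = Filling.swap (w.trans T.1) i := by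
      intro w
      refine Equiv.ext fun b => ?_
      simp only [t, Filling.swap, Equiv.trans_apply]
      rw [← T.1.injective.swap_apply, Equiv.apply_symm_apply, Equiv.apply_symm_apply]
    refine Finset.sum_involution (fun w _ => w.trans t) ?_ ?_ ?_ ?_
    · intro w _
      rw [hswap, gen_smul_sorted_swap, Equiv.Perm.sign_trans, hsign]
      simp
    · intro w _ _ e
      refine hne ?_
      have h1 := congrArg (fun σ => σ (w.symm (T.1.symm i.lo))) e
      simpa [t] using h1.symm
    · intro w hw
      rw [mem_rowStabilizer] at hw ⊢
      intro b
      rw [Equiv.trans_apply, ht, hw]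
    · intro w _
      refine Equiv.ext fun b => ?_
      simp [t]
  · have hd : i ∈ T.Des := h.le
    unfold SRT.step
    rw [dif_pos hd, dif_neg h.ne', Option.elim_some]
    refine Finset.sum_congr rfl fun w hw => ?_
    rw [gen_smul_sorted_of_not_drop]
    · rfl
    · refine not_lt.2 (le_of_lt (columnReading_lt_of_ribbonRow_lt ?_))
      simpa only [Equiv.symm_trans_apply, ribbonRow_symm hw] using h

end Sorted

/-! ### Homomorphisms with a given leading tableau -/

/-- Every letter of `T` lies in the column in which the source tableau has it. -/
def Filling.SameColumns (T : Filling α) : Prop := ∀ b, ((sourceFilling α).symm (T b)).1 = b.1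

theorem SIT.isDescent_iff {U : SIT β} (hU : U.Des = compSet α) (i : Gen n) :
    U.IsDescent i ↔ i.1 ∈ compSet α := by
  rw [← hU]
  refine ⟨fun h => ⟨i, rfl, h⟩, ?_⟩
  rintro ⟨j, hj, h⟩
  rwa [← Subtype.ext hj]

/-- The leading coefficient of `sorted U T` is `1` or `0`, and it is `1` exactly if `T` comes
from the column reading filling by permuting letters within the columns: only for these `T` do
the reduced expressions avoid the descents of `U`. -/
theorem sorted_basisVec_leading {L : LinearOrder (SIT β)} (hL : IsLinearExtension L) {U : SIT β}
    (hU : U.Des = compSet α) (T : Filling α) :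
    SupportedBelow L U (sorted (V.basisVec U) T) ∧
      (sorted (V.basisVec U) T).coords U = open Classical in if T.SameColumns then 1 else 0 := by
  classical
  have main : ∀ (N : ℕ) (T : Filling α), dropEnergy T = N →
      SupportedBelow L U (sorted (V.basisVec U) T) ∧
        (sorted (V.basisVec U) T).coords U = if T.SameColumns then 1 else 0 := by
    intro N
    induction N using Nat.strong_induction_on with
    | _ N ih =>
      intro T hN
      by_cases hT : ∃ i, T.Drop i
      · obtain ⟨i, hi⟩ := hT
        obtain ⟨h1, h2⟩ := ih _ (hN ▸ dropEnergy_swap_lt hi) (T.swap i) rfl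
        rw [sorted_of_drop _ T hi]
        refine ⟨h1.gen_smul hL i, ?_⟩
        rw [h1.coords_gen_smul hL i, h2]
        have hdes := (SIT.isDescent_iff hU i).trans (sourceFilling_symm_fst_lt_iff i).symm
        by_cases hd : U.IsDescent i
        · rw [if_pos hd, if_neg]
          intro hS
          have hlt := hdes.1 hd
          have e1 := hS (T.symm i.lo)
          have e2 := hS (T.symm i.hi)
          rw [Equiv.apply_symm_apply] at e1 e2
          rw [e1, e2] at hlt
          exact lt_asymm hi (columnReading_lt_of_fst_lt hlt)
        · rw [if_neg hd]
          have heq : ((sourceFilling α).symm i.lo).1 = ((sourceFilling α).symm i.hi).1 := by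
            refine le_antisymm (not_lt.1 fun h => ?_) (not_lt.1 fun h => hd (hdes.2 h))
            have := sourceFilling_lt_of_fst_lt h
            rw [Equiv.apply_symm_apply, Equiv.apply_symm_apply] at this
            exact lt_asymm this i.lo_lt_hi
          have hcol : ∀ x, ((sourceFilling α).symm (Equiv.swap i.lo i.hi x)).1
              = ((sourceFilling α).symm x).1 := by
            intro x
            rw [Equiv.swap_apply_def]
            split_ifs with g1 g2
            · rw [g1, heq]
            · rw [g2, heq]
            · rfl
          have : (T.swap i).SameColumns ↔ T.SameColumns := by
            unfold Filling.SameColumns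
            simp only [Filling.swap, Equiv.trans_apply, hcol]
          simp only [this]
      · have hcr : T = columnReading α := by
          refine Filling.eq_of_lt _ _ fun i => ?_
          refine lt_of_le_of_ne (not_lt.1 fun h => hT ⟨i, h⟩) fun e => ?_
          exact i.lo_ne_hi (T.symm.injective ((columnReading α).injective e))
        rw [sorted_of_not_drop _ hT, V.coords_basisVec]
        refine ⟨fun S hS => ?_, ?_⟩
        · rw [V.coords_basisVec, Finsupp.single_apply_ne_zero] at hS
          rw [hS.1]
        · rw [if_pos, Finsupp.single_eq_same]
          rw [hcr]
          exact sourceFilling_symm_columnReading_fst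
  exact main _ T rfl

theorem eq_one_of_sameColumns {w : Equiv.Perm (Box α)} (hw : w ∈ rowStabilizer α)
    (h : Filling.SameColumns (w.trans (sourceFilling α))) : w = 1 := by
  refine Equiv.ext fun b => ?_
  have h1 : (w b).1 = b.1 := by simpa using h b
  have h2 := mem_rowStabilizer.1 hw b
  refine Box.ext h1 ?_
  simp only [ribbonRow, h1] at h2
  simp only [Equiv.Perm.coe_one, id]
  omega

/-- For `U` in `𝔅`, the antisymmetrization of `U` is the image of the source tableau under a
homomorphism with leading tableau `U`. -/
theorem exists_hom_leading {L : LinearOrder (SIT β)} (hL : IsLinearExtension L) {U : SIT β}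
    (hU : U.Des = compSet α) :
    ∃ f : P α →ₗ[H n] V β, SupportedBelow L U (f (P.basisVec (sourceSRT α))) ∧
      coeff f U = 1 := by
  classical
  refine ⟨P.homOfBasis (fun T => antisymmetrized (V.basisVec U) T.1)
    fun i T => gen_smul_antisymmetrized_eq _ T i, ?_, ?_⟩
  · rw [P.homOfBasis_basisVec]
    intro T hT
    unfold antisymmetrized at hT
    rw [V.coords_sum, Finsupp.finsetSum_apply] at hT
    obtain ⟨w, -, hw⟩ := Finset.exists_ne_zero_of_sum_ne_zero hT
    refine (sorted_basisVec_leading hL hU (w.trans (sourceFilling α))).1 T fun h0 => hw ?_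
    rw [← Int.cast_smul_eq_zsmul ℂ, V.coords_smul, Finsupp.smul_apply]
    change _ • (sorted (V.basisVec U) (w.trans (sourceFilling α))).coords T = 0
    rw [h0, smul_zero]
  · unfold coeff
    rw [P.homOfBasis_basisVec]
    unfold antisymmetrized
    rw [V.coords_sum, Finsupp.finsetSum_apply, Finset.sum_eq_single 1]
    · rw [← Int.cast_smul_eq_zsmul ℂ, V.coords_smul, Finsupp.smul_apply,
        (sorted_basisVec_leading hL hU _).2, if_pos]
      · simp
      · intro b
        change ((sourceFilling α).symm (sourceFilling α b)).1 = b.1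
        simp
    · intro w hw hne
      rw [← Int.cast_smul_eq_zsmul ℂ, V.coords_smul, Finsupp.smul_apply,
        (sorted_basisVec_leading hL hU _).2, if_neg, smul_zero]
      exact fun h => hne (eq_one_of_sameColumns hw h)
    · intro h
      exact absurd (mem_rowStabilizer.2 fun b => rfl) h

/-- The coefficients of a homomorphism at the elements of `𝔅`. -/
def coeffMap (α β : Composition n) : (P α →ₗ[H n] V β) →ₗ[ℂ] (B α β → ℂ) where
  toFun f U := coeff f U.1
  map_add' _ _ := rfl
  map_smul' _ _ := rfl

theorem coeffMap_injective {L : LinearOrder (SIT β)} (hL : IsLinearExtension L) :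
    Function.Injective (coeffMap α β) := by
  rw [← LinearMap.ker_eq_bot, LinearMap.ker_eq_bot']
  intro f hf
  by_contra hne
  obtain ⟨U, -, hU⟩ := exists_leading hL f hne
  exact hU (congrFun hf U)

/-- The homomorphisms of `exists_hom_leading` have unitriangular coefficients. -/
theorem coeffMap_surjective {L : LinearOrder (SIT β)} (hL : IsLinearExtension L) :
    Function.Surjective (coeffMap α β) := by
  classical
  choose f hsupp hcoeff using fun U : B α β => exists_hom_leading hL U.2
  let Ψ : (B α β → ℂ) →ₗ[ℂ] (B α β → ℂ) := coeffMap α β ∘ₗ Fintype.linearCombination ℂ f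
  have hΨ : ∀ c U, Ψ c U = ∑ U', c U' * coeff (f U') U.1 := by
    intro c U
    simp only [Ψ, LinearMap.comp_apply, Fintype.linearCombination_apply, map_sum, map_smul,
      Finset.sum_apply, Pi.smul_apply, smul_eq_mul]
    rfl
  have hinj : Function.Injective Ψ := by
    rw [← LinearMap.ker_eq_bot, LinearMap.ker_eq_bot']
    intro c hc
    by_contra hne
    obtain ⟨U₀, hU₀⟩ : ∃ U, c U ≠ 0 := by
      by_contra! h
      exact hne (funext h)
    obtain ⟨U, hU, hmax⟩ := @Finset.exists_max_image _ _ L {U | c U ≠ 0} (fun U : B α β => U.1)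
      ⟨U₀, by simpa using hU₀⟩
    simp only [Finset.mem_filter, Finset.mem_univ, true_and] at hU hmax
    have h1 := congrFun hc U
    rw [hΨ, Finset.sum_eq_single U, hcoeff, mul_one] at h1
    · exact hU h1
    · intro U' _ hU'
      by_contra h2
      obtain ⟨h3, h4⟩ := mul_ne_zero_iff.1 h2
      exact hU' (Subtype.ext (L.le_antisymm _ _ (hmax U' h3) (hsupp U' U.1 h4)))
    · simp
  have hsurj := LinearMap.injective_iff_surjective.1 hinj
  exact Function.Surjective.of_comp (g := Fintype.linearCombination ℂ f) hsurj

theorem IsHomWithLead.coeffMap_eq {L : LinearOrder (SIT β)} {U : B α β} {f : P α →ₗ[H n] V β}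
    (h : IsHomWithLead L U f) : coeffMap α β f = open Classical in Pi.single U 1 := by
  classical
  funext U'
  by_cases hU : U' = U
  · subst hU
    rw [Pi.single_eq_same]
    exact h.2.1
  · rw [Pi.single_eq_of_ne hU]
    exact h.2.2 U' hU

theorem existsUnique_isHomWithLead {L : LinearOrder (SIT β)} (hL : IsLinearExtension L)
    (U : B α β) : ∃! f : P α →ₗ[H n] V β, IsHomWithLead L U f := by
  classical
  obtain ⟨f, hf⟩ := coeffMap_surjective hL (Pi.single U 1 : B α β → ℂ)
  have hc : ∀ U', coeff f U'.1 = (Pi.single U 1 : B α β → ℂ) U' := fun U' => congrFun hf U'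
  refine ⟨f, ⟨?_, ?_, ?_⟩, fun g hg => coeffMap_injective hL (hg.coeffMap_eq.trans hf.symm)⟩
  · have hne : f ≠ 0 := by
      rintro rfl
      have := congrFun hf U
      simp at this
    obtain ⟨U', h1, h2⟩ := exists_leading hL f hne
    rw [hc] at h2
    have : U' = U := by
      by_contra h
      exact h2 (Pi.single_eq_of_ne h _)
    rw [h1, this]
  · rw [hc, Pi.single_eq_same]
  · intro U' h
    rw [hc, Pi.single_eq_of_ne h]

/-! ### The projection of `P_α` onto `V_α` -/

/-- The box of a composition diagram at the beginning of row `i`; in the ribbon diagram it is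
the top box of column `i`. -/
def Box.first (i : Fin α.length) : Box α := ⟨i, ⟨0, α.one_le_blocksFun i⟩⟩

theorem Box.eq_first {x : Box α} (h : x.2.1 = 0) : x = Box.first x.1 := Box.ext rfl h

theorem SRT.first_le (T : SRT α) (x : Box α) : T.1 (Box.first x.1) ≤ T.1 x := by
  rcases Nat.eq_zero_or_pos x.2.1 with h | h
  · rw [← Box.eq_first h]
  · exact (T.lt_of_snd_lt (x := Box.first x.1) (y := x) rfl h).le

theorem SRT.isSIT_iff (T : SRT α) :
    IsSIT T.1 ↔ ∀ i j : Fin α.length, i < j → T.1 (Box.first i) < T.1 (Box.first j) := by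
  refine ⟨fun h i j hij => h.2 _ _ rfl rfl hij, fun h => ⟨fun x y => T.lt_of_snd_lt, ?_⟩⟩
  intro x y hx hy hxy
  rw [Box.eq_first hx, Box.eq_first hy]
  exact h _ _ hxy

/-- Read as a filling of the ribbon, a standard immaculate tableau is a standard ribbon tableau. -/
theorem IsSIT.isSRT {T : Filling α} (h : IsSIT T) : IsSRT T := by
  refine ⟨fun x y hr hc => ?_, fun x y hc hr => h.1 x y hc ((ribbonRow_lt_iff hc).1 hr)⟩
  have h1 := ribbonRow_add_le hc
  have h2 : x.2.1 = 0 := by omega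
  refine (h.2 x (Box.first y.1) h2 rfl hc).trans_le ?_
  rcases Nat.eq_zero_or_pos y.2.1 with h | h'
  · rw [← Box.eq_first h]
  · exact (h.1 (Box.first y.1) y rfl h').le

theorem SRT.step_of_ribbonRow_lt (T : SRT α) {i : Gen n}
    (h : ribbonRow (T.1.symm i.hi) < ribbonRow (T.1.symm i.lo)) :
    ∃ T' : SRT α, T'.1 = T.1.swap i ∧ SRT.step i T = some T' := by
  unfold SRT.step
  rw [dif_pos (show i ∈ T.Des from h.le), dif_neg h.ne']
  exact ⟨_, rfl, rfl⟩

open Classical in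
/-- The image of a standard ribbon tableau in `V_α`: the same filling of the composition diagram
if this is a standard immaculate tableau, and `0` otherwise. -/
def SRT.toV (T : SRT α) : V α := if h : IsSIT T.1 then V.basisVec ⟨T.1, h⟩ else 0

theorem SRT.toV_of_isSIT {T : SRT α} (h : IsSIT T.1) : T.toV = V.basisVec ⟨T.1, h⟩ := dif_pos h

theorem SRT.toV_of_not_isSIT {T : SRT α} (h : ¬ IsSIT T.1) : T.toV = 0 := dif_neg h

theorem SRT.gen_smul_toV (i : Gen n) (T : SRT α) :
    gen i • T.toV = (SRT.step i T).elim 0 SRT.toV := by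
  have hdes := T.mem_Des_iff i
  by_cases hd : i ∈ T.Des
  · have hcol := hdes.1 hd
    have h1 := ribbonRow_add_le hcol
    by_cases hr : ribbonRow (T.1.symm i.lo) = ribbonRow (T.1.symm i.hi)
    · have hstep : SRT.step i T = none := by
        unfold SRT.step
        rw [dif_pos hd, dif_pos hr]
      rw [hstep, Option.elim_none]
      by_cases hT : IsSIT T.1
      · rw [SRT.toV_of_isSIT hT, V.gen_smul_basisVec]
        have hlo : (T.1.symm i.lo).2.1 = 0 := by omega
        -- The first letter of the row of `i + 1` exceeds `i`, so it is `i + 1`.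
        have hhi : (T.1.symm i.hi).2.1 = 0 := by
          by_contra hne
          have h2 := hT.2 _ (Box.first (T.1.symm i.hi).1) hlo rfl hcol
          have h3 := T.lt_of_snd_lt (x := Box.first (T.1.symm i.hi).1) (y := T.1.symm i.hi) rfl
            (Nat.pos_of_ne_zero hne)
          rw [Equiv.apply_symm_apply] at h2 h3
          rw [← Subtype.coe_lt_coe] at h2 h3
          simp only [Gen.lo, Gen.hi] at h2 h3
          omega
        unfold SIT.step
        rw [dif_pos (show SIT.IsDescent ⟨T.1, hT⟩ i from hcol), dif_pos ⟨hlo, hhi⟩,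
          Option.elim_none]
      · rw [SRT.toV_of_not_isSIT hT, smul_zero]
    · have hlt : ribbonRow (T.1.symm i.hi) < ribbonRow (T.1.symm i.lo) := by omega
      obtain ⟨T', hT', hstep⟩ := T.step_of_ribbonRow_lt hlt
      rw [hstep, Option.elim_some]
      by_cases hT : IsSIT T.1
      · rw [SRT.toV_of_isSIT hT, V.gen_smul_basisVec]
        unfold SIT.step
        rw [dif_pos (show SIT.IsDescent ⟨T.1, hT⟩ i from hcol)]
        split_ifs with hc
        · rw [Option.elim_none, SRT.toV_of_not_isSIT]
          intro h
          have h2 := h.2 _ _ hc.1 hc.2 hcol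
          rw [hT'] at h2
          simp only [Filling.swap, Equiv.trans_apply, Equiv.apply_symm_apply,
            Equiv.swap_apply_left, Equiv.swap_apply_right] at h2
          exact lt_asymm h2 i.lo_lt_hi
        · have hs := SIT.isSIT_swap ⟨T.1, hT⟩ i hcol hc
          rw [Option.elim_some, SRT.toV_of_isSIT (T := T') (by rw [hT']; exact hs)]
          congr 1
          exact Subtype.ext hT'.symm
      · rw [SRT.toV_of_not_isSIT hT, smul_zero, SRT.toV_of_not_isSIT]
        contrapose! hT
        rw [SRT.isSIT_iff] at hT ⊢
        intro a b hab
        have h2 := hT a b hab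
        rw [hT'] at h2
        have h3 := lt_swap_iff i h2 ?_
        · simpa [Filling.swap] using h3
        · rintro ⟨e1, e2⟩
          have e3 : Box.first a = T.1.symm i.hi := by
            rw [← Filling.swap_symm_lo, ← e1, Equiv.symm_apply_apply]
          have e4 : Box.first b = T.1.symm i.lo := by
            rw [← Filling.swap_symm_hi, ← e2, Equiv.symm_apply_apply]
          rw [← e3, ← e4] at hcol
          exact lt_asymm hcol hab
  · have hstep : SRT.step i T = some T := by
      unfold SRT.step
      rw [dif_neg hd]
    rw [hstep, Option.elim_some]
    by_cases hT : IsSIT T.1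
    · rw [SRT.toV_of_isSIT hT, V.gen_smul_basisVec,
        (SIT.step_eq_self_iff i ⟨T.1, hT⟩).2 fun h => hd (hdes.2 h), Option.elim_some]
    · rw [SRT.toV_of_not_isSIT hT, smul_zero]

/-- The canonical projection of `P_α` onto `V_α`. -/
def projection (α : Composition n) : P α →ₗ[H n] V α := P.homOfBasis SRT.toV SRT.gen_smul_toV

theorem projection_basisVec (T : SRT α) : projection α (P.basisVec T) = T.toV :=
  P.homOfBasis_basisVec _ _ T

/-- The linear section of the projection that reads standard immaculate tableaux as standard
ribbon tableaux. -/
def projectionSection (α : Composition n) : V α →ₗ[ℂ] P α :=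
  (Finsupp.linearCombination ℂ fun T : SIT α => P.basisVec ⟨T.1, T.2.isSRT⟩ :
    (SIT α →₀ ℂ) →ₗ[ℂ] P α)

theorem projectionSection_basisVec (T : SIT α) :
    projectionSection α (V.basisVec T) = P.basisVec ⟨T.1, T.2.isSRT⟩ := by
  change Finsupp.linearCombination ℂ (fun T : SIT α => P.basisVec ⟨T.1, T.2.isSRT⟩)
    (Finsupp.single T 1) = _
  rw [Finsupp.linearCombination_single, one_smul]

theorem V.induction {p : V α → Prop} (zero : p 0) (add : ∀ v w, p v → p w → p (v + w))
    (smul : ∀ (c : ℂ) T, p (c • V.basisVec T)) (v : V α) : p v := by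
  refine Finsupp.induction_linear (v : SIT α →₀ ℂ) zero add fun T c => ?_
  have := smul c T
  rwa [show c • V.basisVec T = (Finsupp.single T c : SIT α →₀ ℂ) from
    Finsupp.smul_single_one T c] at this

theorem projection_projectionSection (v : V α) : projection α (projectionSection α v) = v := by
  induction v using V.induction with
  | zero => rw [map_zero, map_zero]
  | add v w hv hw => rw [map_add, map_add, hv, hw]
  | smul c T =>
    rw [map_smul, LinearMap.map_smul_of_tower, projectionSection_basisVec,
      projection_basisVec, SRT.toV_of_isSIT T.2]

section Factor

variable {M : Type*} [AddCommGroup M] [Module ℂ M] [Module (H n) M] [IsScalarTower ℂ (H n) M]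

/-- The kernel of the projection is spanned by the standard ribbon tableaux that are not
immaculate. -/
theorem exists_comp_projection (f : P α →ₗ[H n] M)
    (hf : ∀ T : SRT α, ¬ IsSIT T.1 → f (P.basisVec T) = 0) :
    ∃ g : V α →ₗ[H n] M, g ∘ₗ projection α = f := by
  have key : ∀ v, f (projectionSection α (projection α v)) = f v := by
    intro v
    induction v using P.induction with
    | zero => simp only [map_zero]
    | add v w hv hw => simp only [map_add, hv, hw]
    | smul c T =>
      rw [LinearMap.map_smul_of_tower (projection α), map_smul, LinearMap.map_smul_of_tower,
        LinearMap.map_smul_of_tower f, projection_basisVec]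
      congr 1
      by_cases hT : IsSIT T.1
      · rw [SRT.toV_of_isSIT hT, projectionSection_basisVec]
      · rw [SRT.toV_of_not_isSIT hT, map_zero, map_zero, hf T hT]
  refine ⟨homOfGen (f.restrictScalars ℂ ∘ₗ projectionSection α) fun i v => ?_,
    LinearMap.ext key⟩
  conv_lhs => rw [← projection_projectionSection v, ← map_smul]
  exact (key _).trans (map_smul f _ _)

end Factor

/-! ### The kernel of the projection -/

theorem piInterval_self_add_one (m : ℕ) : piInterval n (m + 1) m = 1 := by
  simp [piInterval]

theorem piInterval_eq_mul (i : Gen n) {m : ℕ} (h : i.1 ≤ m) :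
    piInterval n i.1 m = gen i * piInterval n (i.1 + 1) m := by
  have e : m + 1 - i.1 = (m + 1 - (i.1 + 1)) + 1 := by omega
  simp only [piInterval]
  rw [e, List.range'_succ, List.map_cons, List.prod_cons]
  congr 1
  exact dif_pos i.2

/-- The filling obtained from the source tableau by giving the letter `k` to the first box of
part `j`, and shifting the letters `k, …, α_1 + ⋯ + α_j` up by one. -/
def IsShifted (j : Fin α.length) (k : ℕ) (T : Filling α) : Prop :=
  (T (Box.first j)).1 = k ∧ ∀ b, b ≠ Box.first j →
    (T b).1 = if k ≤ (sourceFilling α b).1 ∧ (sourceFilling α b).1 ≤ α.sizeUpTo j.1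
      then (sourceFilling α b).1 + 1 else (sourceFilling α b).1

theorem sourceFilling_first (j : Fin α.length) :
    (sourceFilling α (Box.first j)).1 = α.sizeUpTo j.1 + 1 := by
  rw [sourceFilling_val]
  rfl

/-- The images of the source tableau under the words `π_k ⋯ π_{m_j}`. -/
theorem exists_isShifted (j : Fin α.length) (hj : α.blocksFun j ≠ 1) (d : ℕ)
    (hd : α.sizeUpTo (j.1 - 1) + d ≤ α.sizeUpTo j.1) :
    ∃ T : SRT α, IsShifted j (α.sizeUpTo j.1 + 1 - d) T.1 ∧
      piInterval n (α.sizeUpTo j.1 + 1 - d) (α.sizeUpTo j.1) • P.basisVec (sourceSRT α)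
        = P.basisVec T := by
  induction d with
  | zero =>
    refine ⟨sourceSRT α, ⟨sourceFilling_first j, fun b _ => ?_⟩, ?_⟩
    · rw [if_neg (by omega)]
      rfl
    · rw [Nat.sub_zero, piInterval_self_add_one, one_smul]
  | succ d ih =>
    obtain ⟨T, ⟨hT1, hT2⟩, hT⟩ := ih (by omega)
    have hm := α.sizeUpTo_strict_mono j.2
    have hmn := α.sizeUpTo_le (j.1 + 1)
    let i : Gen n := ⟨α.sizeUpTo j.1 - d, by omega, by omega⟩
    have hk : α.sizeUpTo j.1 + 1 - (d + 1) = i.1 := by simp only [i]; omega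
    have hk' : α.sizeUpTo j.1 + 1 - d = i.1 + 1 := by simp only [i]; omega
    have hik : i.1 ≤ α.sizeUpTo j.1 := by simp only [i]; omega
    have hik' : α.sizeUpTo (j.1 - 1) < i.1 := by simp only [i]; omega
    rw [hk'] at hT1 hT2 hT
    rw [hk]
    clear_value i
    have hhi : T.1.symm i.hi = Box.first j := by
      rw [Equiv.symm_apply_eq]
      exact (Subtype.ext hT1).symm
    obtain ⟨b, hb⟩ : ∃ b, b = (sourceFilling α).symm i.lo := ⟨_, rfl⟩
    have hbval : (sourceFilling α b).1 = i.1 := by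
      rw [hb, Equiv.apply_symm_apply]
      rfl
    have hbj : b ≠ Box.first j := by
      rintro rfl
      rw [sourceFilling_first] at hbval
      omega
    have hlo : T.1.symm i.lo = b := by
      rw [Equiv.symm_apply_eq]
      refine (Subtype.ext ?_).symm
      rw [hT2 b hbj, if_neg (by omega), hbval]
      rfl
    have hbcol : b.1 < j := by
      have h1 := sourceFilling_symm_bounds (α := α) i.lo
      rw [← hb] at h1
      exact lt_of_sizeUpTo_lt (α := α) (h1.1.trans_le hik)
    have hrow : ribbonRow (T.1.symm i.hi) < ribbonRow (T.1.symm i.lo) := by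
      rw [hhi, hlo]
      have h1 := α.one_le_blocksFun j
      let y : Box α := ⟨j, ⟨α.blocksFun j - 1, by omega⟩⟩
      have h2 := ribbonRow_add_le (x := b) (y := y) hbcol
      have h3 : ribbonRow (Box.first j) < ribbonRow y :=
        (ribbonRow_lt_iff (x := Box.first j) (y := y) rfl).2 (by change 0 < α.blocksFun j - 1; omega)
      omega
    obtain ⟨T', hT', hstep⟩ := T.step_of_ribbonRow_lt hrow
    refine ⟨T', ⟨?_, fun c hc => ?_⟩, ?_⟩
    · rw [hT', Filling.swap, Equiv.trans_apply, ← hhi, Equiv.apply_symm_apply,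
        Equiv.swap_apply_right]
      rfl
    · have h1 : T.1 c ≠ i.hi := fun h => hc (by rw [← hhi, ← h, Equiv.symm_apply_apply])
      rw [hT', Filling.swap, Equiv.trans_apply]
      by_cases h2 : T.1 c = i.lo
      · have h3 : c = b := by rw [← hlo, ← h2, Equiv.symm_apply_apply]
        rw [h2, Equiv.swap_apply_left, h3, hbval, if_pos ⟨le_rfl, hik⟩]
        rfl
      · have h3 : (sourceFilling α c).1 ≠ i.1 := by
          intro h
          refine h2 ?_
          have : c = b := (sourceFilling α).injective (Subtype.ext (h.trans hbval.symm))
          rw [this, ← hlo, Equiv.apply_symm_apply]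
        rw [Equiv.swap_apply_of_ne_of_ne h2 h1, hT2 c hc]
        split_ifs <;> omega
    · rw [piInterval_eq_mul i hik, mul_smul, hT, P.gen_smul_basisVec, hstep, Option.elim_some]

/-- Every standard ribbon tableau whose consecutive parts `j'` and `j` have their first letters in
the wrong order is reached from the shifted source tableau: while some exchange of letters other than
these two can be undone, undo it. -/
theorem hom_eq_zero_of_shifted {M : Type*} [AddCommGroup M] [Module ℂ M] [Module (H n) M]
    [IsScalarTower ℂ (H n) M] (f : P α →ₗ[H n] M) {j' j : Fin α.length} (hj : j'.1 + 1 = j.1)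
    (S : SRT α) (hS : IsShifted j (α.sizeUpTo j'.1 + 1) S.1) (hf : f (P.basisVec S) = 0)
    (T : SRT α) (hT : T.1 (Box.first j) < T.1 (Box.first j')) : f (P.basisVec T) = 0 := by
  induction T using SRT.induction_swap with
  | h T ih =>
    by_cases hex : ∃ i : Gen n, (T.1.symm i.hi).1 < (T.1.symm i.lo).1 ∧
        ¬ (T.1 (Box.first j) = i.lo ∧ T.1 (Box.first j') = i.hi)
    · obtain ⟨i, hi, hne⟩ := hex
      obtain ⟨T', h1, h2⟩ := T.exists_swap i hi
      rw [← h2, map_smul, ih T' i hi h1 h2, smul_zero]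
      rw [h1]
      exact lt_swap_iff i hT hne
    · push Not at hex
      suffices T = S by rw [this, hf]
      refine Subtype.ext (Filling.eq_of_lt _ _ fun i => ?_)
      obtain ⟨hS1, hS2⟩ := hS
      have hm := α.sizeUpTo_strict_mono j'.2
      rw [hj] at hm
      have hex' := hex i
      have hlt := i.lo_lt_hi
      rw [← T.1.apply_symm_apply i.lo, ← T.1.apply_symm_apply i.hi] at hlt
      have elo := T.1.apply_symm_apply i.lo
      have ehi := T.1.apply_symm_apply i.hi
      generalize T.1.symm i.lo = x at *
      generalize T.1.symm i.hi = y at *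
      rw [← Subtype.coe_lt_coe]
      have hfirst := sourceFilling_first j
      -- Only the first box of part `j` moves down in the order of the letters.
      have mono : y ≠ Box.first j → sourceFilling α x < sourceFilling α y →
          (S.1 x).1 < (S.1 y).1 := by
        intro hy hxy
        have hyv : (sourceFilling α y).1 ≠ α.sizeUpTo j.1 + 1 := fun h =>
          hy ((sourceFilling α).injective (Subtype.ext (h.trans hfirst.symm)))
        rw [← Subtype.coe_lt_coe] at hxy
        rw [hS2 y hy]
        by_cases hx : x = Box.first j
        · rw [hx, hS1]
          rw [hx, hfirst] at hxy
          split_ifs <;> omega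
        · rw [hS2 x hx]
          split_ifs <;> omega
      rcases lt_trichotomy x.1 y.1 with h | h | h
      · by_cases hy : y = Box.first j
        · subst hy
          have h1 : x.1.1 < j.1 := h
          have hxj : x.1 ≠ j' := by
            intro e
            have h2 := T.first_le x
            rw [e] at h2
            exact absurd (hT.trans_le h2) (lt_asymm hlt)
          have h2 : x.1.1 ≠ j'.1 := fun e => hxj (Fin.ext e)
          have h3 : α.sizeUpTo (x.1.1 + 1) ≤ α.sizeUpTo j'.1 :=
            α.monotone_sizeUpTo (by omega)
          have h4 := sourceFilling_symm_bounds (α := α) (sourceFilling α x)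
          rw [Equiv.symm_apply_apply] at h4
          have hx : x ≠ Box.first j := fun e => by rw [e] at hlt; exact lt_irrefl _ hlt
          rw [hS1, hS2 x hx, if_neg (by omega)]
          omega
        · exact mono hy (sourceFilling_lt_of_fst_lt h)
      · have h1 := T.snd_lt_of_lt h hlt
        have hy : y ≠ Box.first j := by
          rintro rfl
          exact absurd h1 (Nat.not_lt_zero _)
        exact mono hy (sourceFilling_lt_of_snd_lt h h1)
      · obtain ⟨e1, e2⟩ := hex' h
        have hx : x = Box.first j := T.1.injective (elo.trans e1.symm)
        have hy : y = Box.first j' := T.1.injective (ehi.trans e2.symm)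
        have hne : Box.first j' ≠ Box.first j := by
          intro e
          have := congrArg (fun b : Box α => b.1.1) e
          simp only [Box.first] at this
          omega
        rw [hx, hy, hS1, hS2 _ hne, sourceFilling_first, if_pos ⟨le_rfl, hm⟩]
        omega

/-- A standard ribbon tableau that is not immaculate has the first letters of two consecutive
parts in the wrong order, and the second of these parts is not `1`. -/
theorem SRT.exists_first_lt (T : SRT α) (hT : ¬ IsSIT T.1) :
    ∃ j' j : Fin α.length, j'.1 + 1 = j.1 ∧ α.blocksFun j ≠ 1 ∧
      T.1 (Box.first j) < T.1 (Box.first j') := by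
  by_contra! hcon
  refine hT (T.isSIT_iff.2 ?_)
  have consec : ∀ j' j : Fin α.length, j'.1 + 1 = j.1 → T.1 (Box.first j') < T.1 (Box.first j) := by
    intro j' j hj
    by_cases h1 : α.blocksFun j = 1
    · refine T.2.1 _ _ ?_ (Fin.lt_def.2 (by simp only [Box.first]; omega))
      have h2 := α.sizeUpTo_succ' j
      simp only [ribbonRow, Box.first, hj]
      omega
    · refine lt_of_le_of_ne (hcon j' j hj h1) fun e => ?_
      have := congrArg (fun b : Box α => b.1.1) (T.1.injective e)
      simp only [Box.first] at this
      omega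
  have main : ∀ b (hb : b < α.length) (a : Fin α.length), a.1 < b →
      T.1 (Box.first a) < T.1 (Box.first ⟨b, hb⟩) := by
    intro b
    induction b with
    | zero => intro _ a h; omega
    | succ b ih =>
      intro hb a hab
      have h1 := consec ⟨b, by omega⟩ ⟨b + 1, hb⟩ rfl
      rcases Nat.lt_succ_iff_lt_or_eq.1 hab with h | h
      · exact (ih (by omega) a h).trans h1
      · have : a = ⟨b, by omega⟩ := Fin.ext h
        rwa [this]
  exact fun i j hij => main j.1 j.2 i hij

theorem exists_shifted {i : ℕ} (hi : i ∈ calI α) :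
    ∃ (j : Fin α.length) (S : SRT α), j.1 = i ∧ IsShifted j (α.sizeUpTo (i - 1) + 1) S.1 ∧
      piInterval n (α.sizeUpTo (i - 1) + 1) (α.sizeUpTo i) • P.basisVec (sourceSRT α)
        = P.basisVec S := by
  obtain ⟨_, hlt, hne⟩ := hi
  have hm : α.sizeUpTo (i - 1) ≤ α.sizeUpTo i := α.monotone_sizeUpTo (by omega)
  obtain ⟨S, h1, h2⟩ := exists_isShifted ⟨i, hlt⟩ hne (α.sizeUpTo i - α.sizeUpTo (i - 1))
    (by simp only; omega)
  have e : α.sizeUpTo i + 1 - (α.sizeUpTo i - α.sizeUpTo (i - 1)) = α.sizeUpTo (i - 1) + 1 := by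
    omega
  simp only [e] at h1 h2
  exact ⟨_, S, rfl, h1, h2⟩

/-- The words `π_{[m_{i-1} + 1, m_i]}` annihilate the source tableau of `V_α`. -/
theorem projection_piInterval_smul {i : ℕ} (hi : i ∈ calI α) :
    projection α (piInterval n (α.sizeUpTo (i - 1) + 1) (α.sizeUpTo i) •
      P.basisVec (sourceSRT α)) = 0 := by
  obtain ⟨j, S, rfl, hS, h⟩ := exists_shifted hi
  have hj1 : 1 ≤ j.1 := hi.1
  have hjl := j.2
  rw [h, projection_basisVec, SRT.toV_of_not_isSIT]
  let j' : Fin α.length := ⟨j.1 - 1, by omega⟩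
  have hm := α.sizeUpTo_strict_mono j'.2
  have e : j'.1 + 1 = j.1 := by simp only [j']; omega
  rw [e] at hm
  intro hsit
  have h1 := S.isSIT_iff.1 hsit j' j (Fin.lt_def.2 (by omega))
  have hne : Box.first j' ≠ Box.first j := by
    intro e'
    have := congrArg (fun b : Box α => b.1.1) e'
    simp only [Box.first] at this
    omega
  rw [← Subtype.coe_lt_coe, hS.1, hS.2 _ hne, sourceFilling_first] at h1
  change (if α.sizeUpTo j'.1 + 1 ≤ α.sizeUpTo j'.1 + 1 ∧ _ then _ else _) <
    α.sizeUpTo j'.1 + 1 at h1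
  rw [if_pos ⟨le_rfl, hm⟩] at h1
  omega

/-- The kernel of the projection onto `V_α` is generated by the vectors
`π_{[m_{i-1} + 1, m_i]} · T_α` with `i ∈ I(α)`. -/
theorem exists_comp_projection_of_piInterval {M : Type*} [AddCommGroup M] [Module ℂ M]
    [Module (H n) M] [IsScalarTower ℂ (H n) M] (f : P α →ₗ[H n] M)
    (hf : ∀ i ∈ calI α, piInterval n (α.sizeUpTo (i - 1) + 1) (α.sizeUpTo i) •
      f (P.basisVec (sourceSRT α)) = 0) :
    ∃ g : V α →ₗ[H n] M, g ∘ₗ projection α = f := by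
  refine exists_comp_projection f fun T hT => ?_
  obtain ⟨j', j, hj, hne, hlt⟩ := T.exists_first_lt hT
  have hmem : j.1 ∈ calI α := ⟨by omega, j.2, hne⟩
  obtain ⟨k, S, hk, hS, h⟩ := exists_shifted hmem
  obtain rfl : k = j := Fin.ext hk
  have e : k.1 - 1 = j'.1 := by omega
  rw [e] at hS
  refine hom_eq_zero_of_shifted f hj S hS ?_ T hlt
  rw [← h, map_smul]
  exact hf _ hmem

/-! ### The space of homomorphisms from `V_α` to `V_β` -/

/-- The coefficients at `𝔅` of the composition of a homomorphism with the projection. -/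
def coeffMapProjection (α β : Composition n) : (V α →ₗ[H n] V β) →ₗ[ℂ] (B α β → ℂ) where
  toFun g := coeffMap α β (g ∘ₗ projection α)
  map_add' _ _ := rfl
  map_smul' _ _ := rfl

theorem coeffMapProjection_injective {L : LinearOrder (SIT β)} (hL : IsLinearExtension L) :
    Function.Injective (coeffMapProjection α β) := by
  intro g g' h
  refine LinearMap.ext fun v => ?_
  rw [← projection_projectionSection v]
  exact LinearMap.congr_fun (coeffMap_injective hL h) _

theorem range_coeffMapProjection {L : LinearOrder (SIT β)} (hL : IsLinearExtension L)
    (f : B α β → (P α →ₗ[H n] V β)) (hf : ∀ U, IsHomWithLead L U (f U)) :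
    LinearMap.range (coeffMapProjection α β) = coeffSpace f := by
  classical
  have hcoeff : ∀ c : B α β → ℂ, coeffMap α β (∑ U, c U • f U) = c := by
    intro c
    simp only [map_sum, map_smul, (hf _).coeffMap_eq]
    funext U
    simp [Pi.single_apply]
  have hmem : ∀ c : B α β → ℂ, c ∈ coeffSpace f ↔ ∀ i ∈ calI α,
      piInterval n (α.sizeUpTo (i - 1) + 1) (α.sizeUpTo i) •
        (∑ U, c U • f U) (P.basisVec (sourceSRT α)) = 0 := by
    intro c
    refine forall₂_congr fun i _ => ?_
    simp only [LinearMap.sum_apply, LinearMap.smul_apply, Finset.smul_sum]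
    simp only [smul_comm (piInterval n (α.sizeUpTo (i - 1) + 1) (α.sizeUpTo i))]
  ext c
  rw [hmem, LinearMap.mem_range]
  constructor
  · rintro ⟨g, rfl⟩ i hi
    have h : ∑ U, coeffMapProjection α β g U • f U = g ∘ₗ projection α :=
      coeffMap_injective hL (hcoeff _)
    rw [h, ← map_smul, LinearMap.comp_apply, projection_piInterval_smul hi, map_zero]
  · intro h
    obtain ⟨g, hg⟩ := exists_comp_projection_of_piInterval _ h
    refine ⟨g, ?_⟩
    change coeffMap α β (g ∘ₗ projection α) = c
    rw [hg, hcoeff]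

end ZeroHecke

end

theorem theorem5p6 (n : ℕ) (α β : Composition n) (L : LinearOrder (ZeroHecke.SIT β))
    (hL : ZeroHecke.IsLinearExtension L) :
    (∀ U : ZeroHecke.B α β,
      ∃! f : ZeroHecke.P α →ₗ[ZeroHecke.H n] ZeroHecke.V β, ZeroHecke.IsHomWithLead L U f) ∧
    (∀ f : ZeroHecke.B α β → (ZeroHecke.P α →ₗ[ZeroHecke.H n] ZeroHecke.V β),
      (∀ U, ZeroHecke.IsHomWithLead L U (f U)) →
      Module.rank ℂ (ZeroHecke.V α →ₗ[ZeroHecke.H n] ZeroHecke.V β) =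
        Module.rank ℂ (ZeroHecke.coeffSpace f)) := by
  refine ⟨ZeroHecke.existsUnique_isHomWithLead hL, fun f hf => ?_⟩
  rw [← ZeroHecke.range_coeffMapProjection hL f hf]
  exact (LinearEquiv.ofInjective _ (ZeroHecke.coeffMapProjection_injective hL)).rank_eq
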